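/- Consider a chain of $N$ spin-1 sites with a spin-1/2 attached at each end ("in" and "out"). Let $u_g\in\{1,e^{i\pi S^x},e^{i\pi S^y},e^{i\pi S^z}\}$ be the canonical representation of $\mathbb{Z}_2\times\mathbb{Z}_2$ on a spin-1, and let $|x\rangle=(-|1\rangle+|{-1}\rangle)/\sqrt2$, $|y\rangle=i(|1\rangle+|{-1}\rangle)/\sqrt2$, $|z\rangle=|0\rangle$ be the wire basis (the zero-eigenvectors of $S^x,S^y,S^z$). A ground state in the Haldane phase is a normalized matrix product state $|\psi\rangle=\sum_{\sigma,m,\sigma'} l^{\sigma}A^{m_1}\cdots A^{m_N}r^{\sigma'}\,|\sigma\rangle|m_1\cdots m_N\rangle|\sigma'\rangle$ such that (i) the bulk tensor $A$ (of any finite bond dimension) is normal, i.e. injective after blocking, and in canonical form: $\sum_m A^m A^{m\dagger}=1$ and $\sum_m A^{m\dagger}\Lambda^2A^m=\Lambda^2$ for a positive diagonal $\Lambda$ with $\mathrm{tr}\,\Lambda^2=1$; (ii) $\sum_n [u_g]_{mn}A^n=e^{i\varphi_g}V_g^\dagger A^mV_g$ with unitaries $V_g$ that form a non-trivial projective representation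 of $\mathbb{Z}_2\times\mathbb{Z}_2$ (no change of phases makes $V$ a linear representation); (iii) $|\psi\rangle$ is invariant, up to phases, under $P_g\otimes u_g^{\otimes N}\otimes P_g$, where $P_g\in\{1,X,Y,Z\}$ is the corresponding Pauli matrix on the edge spins. Let $\mathcal{E}=\mathcal{E}_1\circ\cdots\circ\mathcal{E}_N$ be an uncorrelated noise, where $\mathcal{E}_i$ is a quantum channel on site $i$ with Kraus operators $K^{(i)}_p$, $\sum_pK_p^{(i)\dagger}K_p^{(i)}=1$. It is strongly symmetric for the canonical representation if for every $g$ there is a phase $e^{i\phi(g)}$ with $U_gK_\alpha U_g^\dagger=e^{i\phi(g)}K_\alpha$ for all Kraus operators $K_\alpha=\bigotimes_iK^{(i)}_{\alpha_i}$ of $\mathcal{E}$, where $U_g=u_g^{\otimes N}$. The MPO tensor of $|\psi\rangle\langle\psi|$ is $M^{m m'}=A^m\otimes (A^{m'})^*$, and that of $\mathcal{E}(|\psi\rangle\langle\psi|)$ at site $i$ is $\sum_p\sum_{n,n'}[K^{(i)}_p]_{mn}\,M^{nn'}\,[K^{(i)\dagger}_p]_{n'm'}$. For a density operator $\rho$ of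 the chain and $a,b\in\{0,1\}$, the identity-gate fidelity is $F_I^{(a,b)}(\rho)=\langle\Phi|\,\mathrm{Tr}_{\mathrm{bulk}}\big[\sum_{s}B_sP_s\,\rho\,P_sB_s^\dagger\big]|\Phi\rangle$ with $|\Phi\rangle=(|00\rangle+|11\rangle)/\sqrt2$ on the two edge spins, $P_s$ the projection onto the outcome string $s\in\{x,y,z\}^N$ in the wire basis, and the by-product operator $B_s=X^{r_X(s)+a}Z^{r_Z(s)+b}$ on "out", where $r_X(s)$ counts the outcomes $x,y$ and $r_Z(s)$ counts the outcomes $y,z$. Then, for every $N$ and every uncorrelated noise $\mathcal{E}$: 1. For every ground state $|\psi\rangle$ in the Haldane phase, the diagonal elements $M^{ss}$ ($s=x,y,z$), in the wire basis, of the MPO tensors of $|\psi\rangle\langle\psi|$ and $\mathcal{E}(|\psi\rangle\langle\psi|)$ coincide at every site if and only if $\mathcal{E}$ is strongly symmetric for the canonical representation. 2. The measurement in the wire basis implements the identity gate with fidelity $1$ on all mixed states that result from ground states in the Haldane phase, with the same by-product operators as without noise (that is, for every ground state $|\psi\rangle$ in the Haldane phase there are $a,b$ with $F_I^{(a,b)}(|\psi\rangle\langle\psi|)=1$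 and $F_I^{(a,b)}(\mathcal{E}(|\psi\rangle\langle\psi|))=1$), if and only if $\mathcal{E}$ is strongly symmetric for the canonical representation. -/

import Mathlib

open scoped Kronecker Matrix

noncomputable section

namespace HaldaneMPO

/-! ### Spin operators and the canonical representation

A spin-1 site is `ℂ³` with the `Sᶻ`-basis `|1⟩, |0⟩, |-1⟩` (indices `0, 1, 2`), an edge spin-1/2 is
`ℂ²` with the `sᶻ`-basis (indices `0, 1`).  The elements of `ℤ₂ × ℤ₂` are written
`(1, 0)` (rotation about the x-axis), `(0, 1)` (z-axis) and `(1, 1)` (y-axis). -/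

/-- The symmetry group `ℤ₂ × ℤ₂`, written additively. -/
abbrev G : Type := ZMod 2 × ZMod 2

/-- Spin-1 operator `Sˣ`. -/
def Sx : Matrix (Fin 3) (Fin 3) ℂ :=
  ((Real.sqrt 2 : ℂ))⁻¹ • !![0, 1, 0; 1, 0, 1; 0, 1, 0]

/-- Spin-1 operator `Sʸ`. -/
def Sy : Matrix (Fin 3) (Fin 3) ℂ :=
  ((Real.sqrt 2 : ℂ))⁻¹ • !![0, -Complex.I, 0; Complex.I, 0, -Complex.I; 0, Complex.I, 0]

/-- Spin-1 operator `Sᶻ`. -/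
def Sz : Matrix (Fin 3) (Fin 3) ℂ :=
  !![1, 0, 0; 0, 0, 0; 0, 0, -1]

/-- The spin component that generates the rotation attached to `g` (zero for the identity). -/
def spin (g : G) : Matrix (Fin 3) (Fin 3) ℂ :=
  if g = (1, 0) then Sx else if g = (1, 1) then Sy else if g = (0, 1) then Sz else 0

/-- The canonical representation `{1, exp(iπSˣ), exp(iπSʸ), exp(iπSᶻ)}` of `ℤ₂ × ℤ₂`. -/
def u (g : G) : Matrix (Fin 3) (Fin 3) ℂ :=
  NormedSpace.exp (((Real.pi : ℂ) * Complex.I) • spin g)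

/-- Pauli matrix `X`. -/
def X : Matrix (Fin 2) (Fin 2) ℂ := !![0, 1; 1, 0]

/-- Pauli matrix `Y`. -/
def Y : Matrix (Fin 2) (Fin 2) ℂ := !![0, -Complex.I; Complex.I, 0]

/-- Pauli matrix `Z`. -/
def Z : Matrix (Fin 2) (Fin 2) ℂ := !![1, 0; 0, -1]

/-- The rotation by `π` of a spin-1/2 attached to `g`, up to a phase. -/
def pauli (g : G) : Matrix (Fin 2) (Fin 2) ℂ :=
  if g = (1, 0) then X else if g = (1, 1) then Y else if g = (0, 1) then Z else 1

/-- The wire basis `|x⟩ = (-|1⟩ + |-1⟩)/√2`, `|y⟩ = i(|1⟩ + |-1⟩)/√2`, `|z⟩ = |0⟩`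
(`s = 0, 1, 2`): the zero-eigenvectors of `Sˣ`, `Sʸ`, `Sᶻ`. -/
def wire : Fin 3 → Fin 3 → ℂ :=
  ![ ((Real.sqrt 2 : ℂ))⁻¹ • ![-1, 0, 1],
     (Complex.I * ((Real.sqrt 2 : ℂ))⁻¹) • ![1, 0, 1],
     ![0, 1, 0] ]

/-! ### Matrix product states in the Haldane phase -/

/-- The product `A^{m₁} A^{m₂} ⋯ A^{m_L}`. -/
def wordProd {D L : ℕ} (A : Fin 3 → Matrix (Fin D) (Fin D) ℂ) (m : Fin L → Fin 3) :
    Matrix (Fin D) (Fin D) ℂ :=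
  (List.ofFn fun i => A (m i)).prod

/-- A normal tensor (injective after blocking finitely many sites). -/
def IsNormalTensor {D : ℕ} (A : Fin 3 → Matrix (Fin D) (Fin D) ℂ) : Prop :=
  ∃ L : ℕ, Submodule.span ℂ (Set.range fun m : Fin L → Fin 3 => wordProd A m) = ⊤

/-- Canonical form.  In terms of `A^m = Γ^m Λ` with the diagonal matrix `Λ > 0` of Schmidt
coefficients these are `∑ Γ Λ² Γ† = 1` and `∑ Γ† Λ² Γ = 1`, with `tr Λ² = 1`. -/
def IsCanonical {D : ℕ} (A : Fin 3 → Matrix (Fin D) (Fin D) ℂ) : Prop :=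
  ∑ m, A m * (A m)ᴴ = 1 ∧
  ∃ Λ : Fin D → ℝ, (∀ i, 0 < Λ i) ∧ ∑ i, Λ i ^ 2 = 1 ∧
    ∑ m, (A m)ᴴ * Matrix.diagonal (fun i => ((Λ i ^ 2 : ℝ) : ℂ)) * A m
      = Matrix.diagonal (fun i => ((Λ i ^ 2 : ℝ) : ℂ))

/-- The projective representation `V` is trivial: after a change of phases it is a linear
representation. -/
def IsLinearizable {D : ℕ} (V : G → Matrix (Fin D) (Fin D) ℂ) : Prop :=
  ∃ β : G → ℂ, (∀ g, ‖β g‖ = 1) ∧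
    ∀ g h, β (g + h) • V (g + h) = (β g • V g) * (β h • V h)

/-- The on-site symmetry acts on the virtual indices through unitaries `V g` which form a
non-trivial projective representation of `ℤ₂ × ℤ₂`. -/
def HasNontrivialFractionalization {D : ℕ} (A : Fin 3 → Matrix (Fin D) (Fin D) ℂ) : Prop :=
  ∃ (φ : G → ℝ) (V : G → Matrix (Fin D) (Fin D) ℂ),
    (∀ g, V g ∈ Matrix.unitaryGroup (Fin D) ℂ) ∧
    (∀ g m, ∑ n, u g m n • A n
      = Complex.exp ((φ g : ℂ) * Complex.I) • ((V g)ᴴ * A m * V g)) ∧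
    ¬ IsLinearizable V

/-- Basis labels of the composite system: edge spin-1/2 "in", `N` spin-1 sites, edge spin-1/2
"out". -/
abbrev Chain (N : ℕ) : Type := Fin 2 × (Fin N → Fin 3) × Fin 2

/-- The operator `M₁ ⊗ ⋯ ⊗ M_N` on the spin-1 sites. -/
def siteProd {N : ℕ} (M : Fin N → Matrix (Fin 3) (Fin 3) ℂ) :
    Matrix (Fin N → Fin 3) (Fin N → Fin 3) ℂ :=
  fun s t => ∏ i, M i (s i) (t i)

/-- The operator `a_in ⊗ M ⊗ b_out` on the composite system. -/
def onChain {N : ℕ} (a : Matrix (Fin 2) (Fin 2) ℂ)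
    (M : Matrix (Fin N → Fin 3) (Fin N → Fin 3) ℂ) (b : Matrix (Fin 2) (Fin 2) ℂ) :
    Matrix (Chain N) (Chain N) ℂ :=
  a ⊗ₖ (M ⊗ₖ b)

/-- The state with amplitudes `⟨σ m₁ ⋯ m_N σ' | ψ⟩ = l^σ A^{m₁} ⋯ A^{m_N} r^{σ'}`. -/
def mpsState {N D : ℕ} (A : Fin 3 → Matrix (Fin D) (Fin D) ℂ) (l r : Fin 2 → Fin D → ℂ) :
    Chain N → ℂ :=
  fun c => l c.1 ⬝ᵥ (wordProd A c.2.1 *ᵥ r c.2.2)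

/-- A ground state in the Haldane phase on `N` spin-1 sites with a spin-1/2 at each end: a
normalized matrix product state, symmetric under `ℤ₂ × ℤ₂` up to phases, with a normal bulk
tensor in canonical form whose virtual symmetry is a non-trivial projective representation. -/
structure HaldaneGroundState (N : ℕ) where
  /-- bond dimension -/
  D : ℕ
  /-- bulk tensor, in the `Sᶻ`-basis -/
  A : Fin 3 → Matrix (Fin D) (Fin D) ℂ
  /-- left end (row vectors) -/
  l : Fin 2 → Fin D → ℂ
  /-- right end (column vectors) -/
  r : Fin 2 → Fin D → ℂ
  normal : IsNormalTensor A
  canonical : IsCanonical A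
  nontrivial : HasNontrivialFractionalization A
  norm_one : ∑ c : Chain N, ‖mpsState A l r c‖ ^ 2 = 1
  symmetric : ∀ g : G, ∃ φ : ℝ,
    onChain (pauli g) (siteProd fun _ => u g) (pauli g) *ᵥ (mpsState A l r : Chain N → ℂ)
      = Complex.exp ((φ : ℂ) * Complex.I) • (mpsState A l r : Chain N → ℂ)

/-- The density operator `|ψ⟩⟨ψ|`. -/
def HaldaneGroundState.density {N : ℕ} (ψ : HaldaneGroundState N) :
    Matrix (Chain N) (Chain N) ℂ :=
  Matrix.vecMulVec (mpsState ψ.A ψ.l ψ.r) (star (mpsState ψ.A ψ.l ψ.r))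

/-! ### Uncorrelated noise and strong symmetry -/

/-- A quantum channel on one spin-1 site, `ρ ↦ ∑ α, K α ρ (K α)†`. -/
structure LocalChannel where
  /-- number of Kraus operators -/
  rank : ℕ
  /-- Kraus operators, in the `Sᶻ`-basis -/
  K : Fin rank → Matrix (Fin 3) (Fin 3) ℂ
  complete : ∑ α, (K α)ᴴ * K α = 1

/-- Kraus operators `K_{α₁} ⊗ ⋯ ⊗ K_{α_N}` of the uncorrelated noise `ℰ₁ ∘ ⋯ ∘ ℰ_N`. -/
def noiseKraus {N : ℕ} (E : Fin N → LocalChannel) (α : (i : Fin N) → Fin (E i).rank) :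
    Matrix (Fin N → Fin 3) (Fin N → Fin 3) ℂ :=
  siteProd fun i => (E i).K (α i)

/-- The uncorrelated noise acting on operators of the composite system (trivially on the edge
spins). -/
def applyNoise {N : ℕ} (E : Fin N → LocalChannel) (ρ : Matrix (Chain N) (Chain N) ℂ) :
    Matrix (Chain N) (Chain N) ℂ :=
  ∑ α : (i : Fin N) → Fin (E i).rank,
    onChain 1 (noiseKraus E α) 1 * ρ * (onChain 1 (noiseKraus E α) 1)ᴴ

/-- Strong symmetry of the channel with Kraus operators `K`: `U_g K_α U_g† = e^{iφ(g)} K_α` with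
a phase that does not depend on `α`. -/
def StronglySymmetric {Γ n κ : Type*} [Fintype n] (U : Γ → Matrix n n ℂ)
    (K : κ → Matrix n n ℂ) : Prop :=
  ∀ g, ∃ φ : ℝ, ∀ α, U g * K α * (U g)ᴴ = Complex.exp ((φ : ℂ) * Complex.I) • K α

/-- The uncorrelated noise is strongly symmetric for the canonical representation. -/
def NoiseStronglySymmetric {N : ℕ} (E : Fin N → LocalChannel) : Prop :=
  StronglySymmetric (fun g : G => siteProd fun _ : Fin N => u g) (noiseKraus E)

/-! ### MPO tensors -/

/-- Local MPO tensors `M^{m m'}` acting on the doubled virtual space. -/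
abbrev MPOTensor (D : ℕ) : Type :=
  Fin 3 → Fin 3 → Matrix (Fin D × Fin D) (Fin D × Fin D) ℂ

/-- The MPO tensor of `|ψ⟩⟨ψ|`: `M^{m m'} = A^m ⊗ (A^{m'})^*`. -/
def pureMPO {D : ℕ} (A : Fin 3 → Matrix (Fin D) (Fin D) ℂ) : MPOTensor D :=
  fun m m' => A m ⊗ₖ (A m').map star

/-- The MPO tensor after the local channel:
`∑ α, ∑ n n', [K_α]_{m n} M^{n n'} [K_α†]_{n' m'}`. -/
def LocalChannel.onMPO {D : ℕ} (E : LocalChannel) (M : MPOTensor D) : MPOTensor D :=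
  fun m m' => ∑ α, ∑ n, ∑ n', (E.K α m n * (E.K α)ᴴ n' m') • M n n'

/-- The elements `⟨s| M |s'⟩` of an MPO tensor in the wire basis. -/
def inWireBasis {D : ℕ} (M : MPOTensor D) : MPOTensor D :=
  fun s s' => ∑ m, ∑ m', (star (wire s m) * wire s' m') • M m m'

/-! ### The identity gate -/

/-- The projection onto the outcome `s` of the measurement in the wire basis. -/
def wireProj (s : Fin 3) : Matrix (Fin 3) (Fin 3) ℂ :=
  Matrix.vecMulVec (wire s) (star (wire s))

/-- Number of outcomes `x` or `y`. -/
def countX {N : ℕ} (s : Fin N → Fin 3) : ℕ :=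
  (Finset.univ.filter fun i => s i = 0 ∨ s i = 1).card

/-- Number of outcomes `y` or `z`. -/
def countZ {N : ℕ} (s : Fin N → Fin 3) : ℕ :=
  (Finset.univ.filter fun i => s i = 1 ∨ s i = 2).card

/-- The Pauli by-product operator `X^{r_X + a} Z^{r_Z + b}`.  The exponents `a, b` do not depend
on the outcomes; they are fixed by the symmetry charge of the resource state
(`a = b = 1` for a singlet such as the AKLT state). -/
def byproduct {N : ℕ} (a b : Fin 2) (s : Fin N → Fin 3) : Matrix (Fin 2) (Fin 2) ℂ :=
  X ^ (countX s + (a : ℕ)) * Z ^ (countZ s + (b : ℕ))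

/-- Partial trace over the spin-1 sites. -/
def traceBulk {N : ℕ} (ρ : Matrix (Chain N) (Chain N) ℂ) :
    Matrix (Fin 2 × Fin 2) (Fin 2 × Fin 2) ℂ :=
  fun p q => ∑ m : Fin N → Fin 3, ρ (p.1, m, p.2) (q.1, m, q.2)

/-- The two-qubit state left after measuring all sites in the wire basis and applying the
by-product operators. -/
def outputState {N : ℕ} (a b : Fin 2) (ρ : Matrix (Chain N) (Chain N) ℂ) :
    Matrix (Fin 2 × Fin 2) (Fin 2 × Fin 2) ℂ :=
  traceBulk (∑ s : Fin N → Fin 3,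
    onChain 1 (siteProd fun i => wireProj (s i)) (byproduct a b s) * ρ *
      (onChain 1 (siteProd fun i => wireProj (s i)) (byproduct a b s))ᴴ)

/-- The ideal resource state `(|00⟩ + |11⟩)/√2` of the identity gate. -/
def bell : Fin 2 × Fin 2 → ℂ :=
  fun p => if p.1 = p.2 then ((Real.sqrt 2 : ℂ))⁻¹ else 0

/-- The identity-gate fidelity of the resource `ρ`. -/
def identityFidelity {N : ℕ} (a b : Fin 2) (ρ : Matrix (Chain N) (Chain N) ℂ) : ℂ :=
  (outputState a b ρ * Matrix.vecMulVec bell (star bell)).trace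

end HaldaneMPO

end

/-! # Noise resilience of the identity gate in the Haldane phase -/

open scoped Kronecker Matrix

noncomputable section

namespace HaldaneMPO

/-! ### The wire basis and the canonical representation -/

/-! Both parts reduce to one local condition: every Kraus operator on every site is diagonal in the
wire basis (`noiseStronglySymmetric_iff`). There `u g` is diagonal with signs `χ g s`, where the `χ
· s` are the three non-trivial characters of the group, so diagonal Kraus operators commute with it.
Conversely, strong symmetry is a selection rule: all non-zero Kraus entries on a site carry the same
character, and completeness, which forbids a zero column, excludes the character of an off-diagonal
entry.

For the MPO tensors, let `B s` be the wire components of `A`. They are linearly independent: they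
transform with distinct characters under conjugation by `V g`, and none vanishes, since otherwise
normality would make some `V g` with `g ≠ 0` a scalar and `V` linearizable. A dual functional
(`exists_dual`) then turns equality of the diagonal elements into vanishing of the sum over `p` of
the squared moduli of the entries `(s, t)`, for `s ≠ t`.

For the gate, the outcome `s` leaves a 2×2 matrix of edge amplitudes, and the fidelity is the sum of
half the squared moduli of their traces after correction. It reaches the total norm exactly when all
corrected matrices are scalar. Symmetry makes the amplitudes multiples of Pauli products, which the
by-products undo (`exists_identityFidelity_eq_one`); diagonal noise only rescales each outcome, with
total weight one. For the converse the AKLT state suffices: fidelity one makes each noisy product of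
wire matrices proportional to the noiseless one, and `exists_mix_wireKraus_eq_smul` splits this into
separate conditions on the sites. -/

lemma inv_sqrt_two_mul_self : ((Real.sqrt 2 : ℂ))⁻¹ * ((Real.sqrt 2 : ℂ))⁻¹ = 1 / 2 := by
  rw [← mul_inv, ← Complex.ofReal_mul, Real.mul_self_sqrt (by norm_num)]; norm_num

lemma star_inv_sqrt_two : star ((Real.sqrt 2 : ℂ))⁻¹ = ((Real.sqrt 2 : ℂ))⁻¹ := by
  simp [Complex.conj_ofReal]

/-- The unitary change of basis from the `Sᶻ`-basis to the wire basis. -/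
def wireUnitary : Matrix (Fin 3) (Fin 3) ℂ := Matrix.of fun s m => star (wire s m)

lemma wireUnitary_apply (s m : Fin 3) : wireUnitary s m = star (wire s m) := rfl

lemma wireUnitary_eq : wireUnitary =
    !![-((Real.sqrt 2 : ℂ))⁻¹, 0, ((Real.sqrt 2 : ℂ))⁻¹;
       -Complex.I * ((Real.sqrt 2 : ℂ))⁻¹, 0, -Complex.I * ((Real.sqrt 2 : ℂ))⁻¹; 0, 1, 0] := by
  ext i j
  fin_cases i <;> fin_cases j <;> simp [wireUnitary, wire]

lemma wireUnitary_conjTranspose : wireUnitaryᴴ =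
    !![-((Real.sqrt 2 : ℂ))⁻¹, Complex.I * ((Real.sqrt 2 : ℂ))⁻¹, 0; 0, 0, 1;
       ((Real.sqrt 2 : ℂ))⁻¹, Complex.I * ((Real.sqrt 2 : ℂ))⁻¹, 0] := by
  ext i j
  fin_cases i <;> fin_cases j <;> simp [wireUnitary, wire, Matrix.conjTranspose_apply]

lemma wireUnitary_mul_conjTranspose : wireUnitary * wireUnitaryᴴ = 1 := by
  have h := inv_sqrt_two_mul_self
  have hI := Complex.I_mul_I
  rw [wireUnitary_conjTranspose, wireUnitary_eq]
  generalize ((Real.sqrt 2 : ℂ))⁻¹ = r at *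
  ext i j
  fin_cases i <;> fin_cases j <;> simp [Matrix.mul_apply, Fin.sum_univ_three] <;> grind

lemma wireUnitary_conjTranspose_mul : wireUnitaryᴴ * wireUnitary = 1 :=
  mul_eq_one_comm.mp wireUnitary_mul_conjTranspose

/-- The sign of the rotation `g` on the state `s` of the wire basis. -/
def χ (g : G) (s : Fin 3) : ℤ :=
  if g = (1, 0) then ![1, -1, -1] s else if g = (1, 1) then ![-1, 1, -1] s
    else if g = (0, 1) then ![-1, -1, 1] s else 1

lemma χ_mul_self (g : G) (s : Fin 3) : χ g s * χ g s = 1 := by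
  revert g s; decide

lemma χ_add (g h : G) (s : Fin 3) : χ (g + h) s = χ g s * χ h s := by
  revert g h s; decide

/-- The columns of `U` diagonalize `S`, and `exp (iπd) = 1 - 2d²` for each of the eigenvalues `0, 1,
-1`. This replaces the exponential by a polynomial in `S`. -/
lemma exp_pi_I_smul {n : Type*} [Fintype n] [DecidableEq n] {S U V : Matrix n n ℂ} {d : n → ℂ}
    (hUV : U * V = 1) (hS : ∀ i j, U i j * d j = (S * U) i j)
    (hd : ∀ i, d i = 0 ∨ d i = 1 ∨ d i = -1) :
    NormedSpace.exp (((Real.pi : ℂ) * Complex.I) • S) = 1 - (2 : ℂ) • (S * S) := by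
  have hVU : V * U = 1 := mul_eq_one_comm.mp hUV
  have hS : U * Matrix.diagonal d * V = S := by
    have : U * Matrix.diagonal d = S * U := by ext i j; rw [Matrix.mul_diagonal, hS]
    rw [this, Matrix.mul_assoc, hUV, mul_one]
  have hV : V = U⁻¹ := (Matrix.inv_eq_right_inv hUV).symm
  have hU : IsUnit U := ⟨⟨U, V, hUV, hVU⟩, rfl⟩
  have h1 : ((Real.pi : ℂ) * Complex.I) • S
      = U * (((Real.pi : ℂ) * Complex.I) • Matrix.diagonal d) * U⁻¹ := by
    rw [← hS, hV, Matrix.mul_smul, Matrix.smul_mul]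
  have h2 : NormedSpace.exp (((Real.pi : ℂ) * Complex.I) • Matrix.diagonal d)
      = 1 - (2 : ℂ) • (Matrix.diagonal d * Matrix.diagonal d) := by
    rw [← Matrix.diagonal_smul, Matrix.exp_diagonal, Matrix.diagonal_mul_diagonal,
      ← Matrix.diagonal_smul, ← Matrix.diagonal_one, Matrix.diagonal_sub]
    congr 1
    funext i
    rw [Pi.coe_exp]
    rcases hd i with h | h | h
    · simp [h]
    · simp [h, ← Complex.exp_eq_exp_ℂ]; norm_num
    · simp [h, ← Complex.exp_eq_exp_ℂ, Complex.exp_neg]; norm_num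
  rw [h1, Matrix.exp_conj _ _ hU, h2, ← hV, Matrix.mul_sub, Matrix.sub_mul, mul_one, hUV,
    Matrix.mul_smul, Matrix.smul_mul, ← hS]
  congr 2
  simp only [Matrix.mul_assoc]
  rw [← Matrix.mul_assoc V U, hVU, one_mul]

lemma u_eq_spin (g : G) : u g = 1 - (2 : ℂ) • (spin g * spin g) := by
  have h := inv_sqrt_two_mul_self
  have hI := Complex.I_mul_I
  unfold u spin
  split_ifs
  -- The columns of `U` are the eigenvectors for `1, 0, -1`, and `V` is the adjoint of `U`; the same
  -- holds for the other two axes.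
  · apply exp_pi_I_smul
      (U := !![1 / 2, ((Real.sqrt 2 : ℂ))⁻¹, 1 / 2; ((Real.sqrt 2 : ℂ))⁻¹, 0,
        -((Real.sqrt 2 : ℂ))⁻¹; 1 / 2, -((Real.sqrt 2 : ℂ))⁻¹, 1 / 2])
      (V := !![1 / 2, ((Real.sqrt 2 : ℂ))⁻¹, 1 / 2; ((Real.sqrt 2 : ℂ))⁻¹, 0,
        -((Real.sqrt 2 : ℂ))⁻¹; 1 / 2, -((Real.sqrt 2 : ℂ))⁻¹, 1 / 2])
      (d := ![1, 0, -1])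
    · generalize ((Real.sqrt 2 : ℂ))⁻¹ = r at *
      ext i j
      fin_cases i <;> fin_cases j <;> simp [Matrix.mul_apply, Fin.sum_univ_three] <;> grind
    · unfold Sx
      generalize ((Real.sqrt 2 : ℂ))⁻¹ = r at *
      intro i j
      fin_cases i <;> fin_cases j <;> simp [Matrix.mul_apply, Fin.sum_univ_three] <;> grind
    · intro i; fin_cases i <;> simp
  · apply exp_pi_I_smul
      (U := !![1 / 2, ((Real.sqrt 2 : ℂ))⁻¹, 1 / 2; Complex.I * ((Real.sqrt 2 : ℂ))⁻¹, 0,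
        -(Complex.I * ((Real.sqrt 2 : ℂ))⁻¹); -(1 / 2), ((Real.sqrt 2 : ℂ))⁻¹, -(1 / 2)])
      (V := !![1 / 2, -(Complex.I * ((Real.sqrt 2 : ℂ))⁻¹), -(1 / 2); ((Real.sqrt 2 : ℂ))⁻¹, 0,
        ((Real.sqrt 2 : ℂ))⁻¹; 1 / 2, Complex.I * ((Real.sqrt 2 : ℂ))⁻¹, -(1 / 2)])
      (d := ![1, 0, -1])
    · generalize ((Real.sqrt 2 : ℂ))⁻¹ = r at *
      ext i j
      fin_cases i <;> fin_cases j <;> simp [Matrix.mul_apply, Fin.sum_univ_three] <;> grind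
    · unfold Sy
      generalize ((Real.sqrt 2 : ℂ))⁻¹ = r at *
      intro i j
      fin_cases i <;> fin_cases j <;> simp [Matrix.mul_apply, Fin.sum_univ_three] <;> grind
    · intro i; fin_cases i <;> simp
  · apply exp_pi_I_smul (U := 1) (V := 1) (d := ![1, 0, -1])
    · simp
    · intro i j
      fin_cases i <;> fin_cases j <;> simp [Sz]
    · intro i; fin_cases i <;> simp
  · simp [NormedSpace.exp_zero]

lemma wireUnitary_mul_u (g : G) :
    wireUnitary * u g = Matrix.diagonal (fun s => (χ g s : ℂ)) * wireUnitary := by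
  have h := inv_sqrt_two_mul_self
  have hI := Complex.I_mul_I
  rw [u_eq_spin, wireUnitary_eq]
  unfold spin χ Sx Sy Sz
  generalize ((Real.sqrt 2 : ℂ))⁻¹ = r at *
  split_ifs <;> ext i j <;> rw [Matrix.diagonal_mul] <;> fin_cases i <;> fin_cases j <;>
    simp [Matrix.mul_apply, Fin.sum_univ_three, Matrix.one_apply] <;> grind

lemma u_eq (g : G) :
    u g = wireUnitaryᴴ * Matrix.diagonal (fun s => (χ g s : ℂ)) * wireUnitary := by
  rw [Matrix.mul_assoc, ← wireUnitary_mul_u, ← Matrix.mul_assoc, wireUnitary_conjTranspose_mul,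
    one_mul]

lemma u_add (g h : G) : u (g + h) = u g * u h := by
  rw [u_eq g, Matrix.mul_assoc, wireUnitary_mul_u, ← Matrix.mul_assoc, Matrix.mul_assoc _ _
    (Matrix.diagonal _), Matrix.diagonal_mul_diagonal, u_eq (g + h)]
  simp [χ_add]

/-! ### Product operators -/

section siteProd
variable {N : ℕ}

lemma siteProd_mul (M M' : Fin N → Matrix (Fin 3) (Fin 3) ℂ) :
    siteProd M * siteProd M' = siteProd fun i => M i * M' i := by
  ext s t
  simp only [siteProd, Matrix.mul_apply]
  rw [Finset.prod_univ_sum, Fintype.piFinset_univ]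
  simp [Finset.prod_mul_distrib]

lemma siteProd_one : siteProd (fun _ : Fin N => (1 : Matrix (Fin 3) (Fin 3) ℂ)) = 1 := by
  ext s t
  by_cases h : s = t
  · subst h; simp [siteProd]
  · obtain ⟨i, hi⟩ := Function.ne_iff.mp h
    rw [Matrix.one_apply_ne h]
    exact Finset.prod_eq_zero (Finset.mem_univ i) (Matrix.one_apply_ne hi)

lemma siteProd_conjTranspose (M : Fin N → Matrix (Fin 3) (Fin 3) ℂ) :
    (siteProd M)ᴴ = siteProd fun i => (M i)ᴴ := by
  ext s t
  simp [siteProd, Matrix.conjTranspose_apply]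

lemma sum_siteProd {κ : Fin N → Type*} [∀ i, Fintype (κ i)]
    (M : (i : Fin N) → κ i → Matrix (Fin 3) (Fin 3) ℂ) :
    ∑ α : (i : Fin N) → κ i, siteProd (fun i => M i (α i)) = siteProd fun i => ∑ p, M i p := by
  classical
  ext s t
  simp only [siteProd, Matrix.sum_apply]
  rw [Finset.prod_univ_sum, Fintype.piFinset_univ]

lemma siteProd_diagonal (d : Fin N → Fin 3 → ℂ) :
    siteProd (fun i => Matrix.diagonal (d i)) = Matrix.diagonal fun s => ∏ i, d i (s i) := by
  ext s t
  by_cases h : s = t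
  · subst h; simp [siteProd]
  · obtain ⟨i, hi⟩ := Function.ne_iff.mp h
    rw [Matrix.diagonal_apply_ne _ h]
    exact Finset.prod_eq_zero (Finset.mem_univ i) (Matrix.diagonal_apply_ne _ hi)

end siteProd

/-! ### Strongly symmetric noise is diagonal in the wire basis -/

/-- The Kraus operators of a local channel in the wire basis. -/
def LocalChannel.wireKraus (E : LocalChannel) (p : Fin E.rank) : Matrix (Fin 3) (Fin 3) ℂ :=
  wireUnitary * E.K p * wireUnitaryᴴ

/-- All Kraus operators are diagonal in the wire basis. -/
def LocalChannel.IsWireDiagonal (E : LocalChannel) : Prop :=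
  ∀ p s t, s ≠ t → E.wireKraus p s t = 0

lemma LocalChannel.wireKraus_mul (E : LocalChannel) (p : Fin E.rank) :
    E.wireKraus p * wireUnitary = wireUnitary * E.K p := by
  rw [wireKraus, Matrix.mul_assoc, wireUnitary_conjTranspose_mul, mul_one]

lemma LocalChannel.wireKraus_complete (E : LocalChannel) :
    ∑ p, (E.wireKraus p)ᴴ * E.wireKraus p = 1 := by
  have h : ∀ p, (E.wireKraus p)ᴴ * E.wireKraus p
      = wireUnitary * ((E.K p)ᴴ * E.K p) * wireUnitaryᴴ := fun p => by
    simp only [wireKraus, Matrix.conjTranspose_mul, Matrix.conjTranspose_conjTranspose,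
      Matrix.mul_assoc]
    rw [← Matrix.mul_assoc wireUnitaryᴴ wireUnitary, wireUnitary_conjTranspose_mul, one_mul]
  rw [Finset.sum_congr rfl fun p _ => h p, ← Finset.sum_mul, ← Finset.mul_sum, E.complete, mul_one,
    wireUnitary_mul_conjTranspose]

lemma LocalChannel.sum_star_wireKraus (E : LocalChannel) (t t' : Fin 3) :
    ∑ p, ∑ s, star (E.wireKraus p s t) * E.wireKraus p s t' = if t = t' then 1 else 0 := by
  have h := congrFun (congrFun E.wireKraus_complete t) t'
  simpa [Matrix.sum_apply, Matrix.mul_apply, Matrix.one_apply] using h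

lemma LocalChannel.exists_wireKraus_ne_zero (E : LocalChannel) (t : Fin 3) :
    ∃ p s, E.wireKraus p s t ≠ 0 := by
  by_contra! h
  have := E.sum_star_wireKraus t t
  simp [h] at this

/-- The three characters multiply to one, so an off-diagonal entry `(s, t)` carries the character of
the third state `c`. An entry `(r, c)` carries the same one only if `χ · r` is trivial, which never
happens. -/
lemma χ_separates {s t c r : Fin 3} (hst : s ≠ t) (hcs : c ≠ s) (hct : c ≠ t) :
    ∃ g, χ g s * χ g t ≠ χ g r * χ g c := by
  revert s t c r; decide

lemma exists_third (s t : Fin 3) : ∃ c, c ≠ s ∧ c ≠ t := by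
  revert s t; decide

lemma siteProd_u_conj_noiseKraus {N : ℕ} (E : Fin N → LocalChannel) (g : G)
    (α : (i : Fin N) → Fin (E i).rank) :
    siteProd (fun _ => wireUnitary) * (siteProd (fun _ => u g) * noiseKraus E α *
      (siteProd fun _ => u g)ᴴ) * (siteProd fun _ => wireUnitary)ᴴ =
    siteProd fun i => Matrix.diagonal (fun s => (χ g s : ℂ)) * (E i).wireKraus (α i) *
      Matrix.diagonal (fun s => (χ g s : ℂ)) := by
  have hd : (Matrix.diagonal (fun s => (χ g s : ℂ)))ᴴ = Matrix.diagonal (fun s => (χ g s : ℂ)) := by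
    rw [Matrix.diagonal_conjTranspose]; congr 1; funext s; simp
  have hu : (wireUnitary * u g)ᴴ = wireUnitaryᴴ * Matrix.diagonal (fun s => (χ g s : ℂ)) := by
    rw [wireUnitary_mul_u, Matrix.conjTranspose_mul, hd]
  rw [Matrix.conjTranspose_mul] at hu
  simp only [noiseKraus, siteProd_conjTranspose, siteProd_mul, LocalChannel.wireKraus]
  congr 1; funext i
  simp only [Matrix.mul_assoc]
  rw [hu, ← Matrix.mul_assoc wireUnitary (u g), wireUnitary_mul_u]
  simp only [Matrix.mul_assoc]

lemma isWireDiagonal_of_stronglySymmetric {N : ℕ} {E : Fin N → LocalChannel}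
    (h : NoiseStronglySymmetric E) (j : Fin N) : (E j).IsWireDiagonal := by
  intro p s t hst
  by_contra hne
  -- The selection rule: comparing matrix elements in the wire basis, every non-vanishing product of
  -- local entries has the same total sign, independently of the Kraus label.
  have hsel : ∀ g, ∃ z : ℂ, ∀ (α : (i : Fin N) → Fin (E i).rank) (a b : Fin N → Fin 3),
      (∀ i, (E i).wireKraus (α i) (a i) (b i) ≠ 0) →
      ∏ i, ((χ g (a i) : ℂ) * χ g (b i)) = z := by
    intro g
    obtain ⟨φ, hφ⟩ := h g
    refine ⟨Complex.exp (φ * Complex.I), fun α a b hab => ?_⟩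
    have h1 := siteProd_u_conj_noiseKraus E g α
    rw [hφ α, Matrix.mul_smul, Matrix.smul_mul, noiseKraus, siteProd_conjTranspose, siteProd_mul,
      siteProd_mul] at h1
    have h2 := congrFun (congrFun h1 a) b
    simp only [Matrix.smul_apply, siteProd, Matrix.mul_diagonal, Matrix.diagonal_mul,
      smul_eq_mul] at h2
    have h3 : ∏ i, (E i).wireKraus (α i) (a i) (b i) ≠ 0 := Finset.prod_ne_zero_iff.mpr
      fun i _ => hab i
    apply mul_right_cancel₀ h3
    rw [← Finset.prod_mul_distrib]
    refine Eq.trans (Finset.prod_congr rfl fun i _ => ?_) h2.symm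
    ring
  obtain ⟨c, hcs, hct⟩ := exists_third s t
  obtain ⟨q, r, hqr⟩ := (E j).exists_wireKraus_ne_zero c
  choose α₀ a₀ hα₀ using fun i => (E i).exists_wireKraus_ne_zero 0
  obtain ⟨g, hg⟩ := χ_separates (r := r) hst hcs hct
  obtain ⟨z, hz⟩ := hsel g
  -- Only site `j` varies. The other sites stay at a fixed non-zero entry of column `0`, so their
  -- sign is a common factor and cancels.
  have key : ∀ (p : Fin (E j).rank) (s t : Fin 3), (E j).wireKraus p s t ≠ 0 →
      ((χ g s : ℂ) * χ g t) *
        ∏ i ∈ Finset.univ.erase j, ((χ g (a₀ i) : ℂ) * χ g 0) = z := by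
    intro p s t hne
    rw [← hz (Function.update α₀ j p) (Function.update a₀ j s) (Function.update (fun _ => 0) j t)]
    · rw [← Finset.mul_prod_erase _ _ (Finset.mem_univ j)]
      congr 1
      · simp
      · refine Finset.prod_congr rfl fun i hi => ?_
        simp [Function.update_of_ne (Finset.ne_of_mem_erase hi)]
    · intro i
      by_cases hi : i = j
      · subst hi; simpa using hne
      · simpa [Function.update_of_ne hi] using hα₀ i
  have hχ : ∀ s, (χ g s : ℂ) ≠ 0 := fun s h0 => by
    have := χ_mul_self g s
    rw [Int.cast_eq_zero.mp h0] at this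
    simp at this
  have h1 := (key p s t hne).trans (key q r c hqr).symm
  have h2 := mul_right_cancel₀ (Finset.prod_ne_zero_iff.mpr fun i _ =>
    mul_ne_zero (hχ (a₀ i)) (hχ 0)) h1
  exact hg (by exact_mod_cast h2)

lemma stronglySymmetric_of_isWireDiagonal {N : ℕ} {E : Fin N → LocalChannel}
    (h : ∀ i, (E i).IsWireDiagonal) : NoiseStronglySymmetric E := by
  intro g
  -- Diagonal matrices commute, so the phase is trivial.
  refine ⟨0, fun α => ?_⟩
  have h1 := siteProd_u_conj_noiseKraus E g α
  have h2 : (siteProd fun i => Matrix.diagonal (fun s => (χ g s : ℂ)) * (E i).wireKraus (α i) *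
      Matrix.diagonal (fun s => (χ g s : ℂ)))
      = siteProd (fun _ => wireUnitary) * noiseKraus E α * (siteProd fun _ => wireUnitary)ᴴ := by
    simp only [noiseKraus, siteProd_conjTranspose, siteProd_mul]
    congr 1; funext i
    change _ = (E i).wireKraus (α i)
    ext s t
    rw [Matrix.mul_diagonal, Matrix.diagonal_mul]
    by_cases hst : s = t
    · subst hst
      have := χ_mul_self g s
      have h3 : (χ g s : ℂ) * χ g s = 1 := by exact_mod_cast this
      linear_combination (E i).wireKraus (α i) s s * h3
    · simp [h i (α i) s t hst]
  rw [h2] at h1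
  have hW : (siteProd fun _ : Fin N => wireUnitary)ᴴ * (siteProd fun _ : Fin N => wireUnitary)
      = 1 := by
    rw [siteProd_conjTranspose, siteProd_mul, wireUnitary_conjTranspose_mul, siteProd_one]
  have h4 : ∀ M : Matrix (Fin N → Fin 3) (Fin N → Fin 3) ℂ,
      (siteProd fun _ : Fin N => wireUnitary)ᴴ * (siteProd (fun _ => wireUnitary) * M *
        (siteProd fun _ : Fin N => wireUnitary)ᴴ) * (siteProd fun _ : Fin N => wireUnitary)
        = M := fun M => by
    simp only [Matrix.mul_assoc]
    rw [hW, mul_one, ← Matrix.mul_assoc, hW, one_mul]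
  rw [← h4 (_ * _ * _), h1, h4]
  simp

lemma noiseStronglySymmetric_iff {N : ℕ} {E : Fin N → LocalChannel} :
    NoiseStronglySymmetric E ↔ ∀ i, (E i).IsWireDiagonal :=
  ⟨isWireDiagonal_of_stronglySymmetric, stronglySymmetric_of_isWireDiagonal⟩

/-! ### Words and on-site changes of basis -/

section words
variable {D L : ℕ}

lemma wordProd_zero (A : Fin 3 → Matrix (Fin D) (Fin D) ℂ) (w : Fin 0 → Fin 3) :
    wordProd A w = 1 := by
  simp [wordProd]

lemma wordProd_succ (A : Fin 3 → Matrix (Fin D) (Fin D) ℂ) (w : Fin (L + 1) → Fin 3) :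
    wordProd A w = A (w 0) * wordProd A (fun i => w i.succ) := by
  simp [wordProd, List.ofFn_succ]

lemma wordProd_gauge (A : Fin 3 → Matrix (Fin D) (Fin D) ℂ) (c : ℂ)
    {V : Matrix (Fin D) (Fin D) ℂ} (hV : V ∈ Matrix.unitaryGroup (Fin D) ℂ) (w : Fin L → Fin 3) :
    wordProd (fun m => c • (Vᴴ * A m * V)) w = c ^ L • (Vᴴ * wordProd A w * V) := by
  have h1 : Vᴴ * V = 1 := Matrix.mem_unitaryGroup_iff'.mp hV
  have h2 : V * Vᴴ = 1 := Matrix.mem_unitaryGroup_iff.mp hV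
  induction L with
  | zero => simp [wordProd_zero, h1]
  | succ L ih =>
    rw [wordProd_succ, ih, wordProd_succ A, Matrix.smul_mul, Matrix.mul_smul, smul_smul, ← pow_succ']
    congr 1
    simp only [Matrix.mul_assoc]
    rw [← Matrix.mul_assoc V Vᴴ, h2, one_mul]

/-- The tensor with components `∑ n, P m n • A n`. -/
def mix (P : Matrix (Fin 3) (Fin 3) ℂ) (A : Fin 3 → Matrix (Fin D) (Fin D) ℂ) :
    Fin 3 → Matrix (Fin D) (Fin D) ℂ :=
  fun m => ∑ n, P m n • A n

lemma mix_mix (P Q : Matrix (Fin 3) (Fin 3) ℂ) (A : Fin 3 → Matrix (Fin D) (Fin D) ℂ) :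
    mix P (mix Q A) = mix (P * Q) A := by
  funext m
  simp only [mix, Matrix.mul_apply, Finset.smul_sum, Finset.sum_smul, smul_smul]
  rw [Finset.sum_comm]

lemma mix_one (A : Fin 3 → Matrix (Fin D) (Fin D) ℂ) : mix 1 A = A := by
  funext m
  simp [mix, Matrix.one_apply]

lemma mix_diagonal (d : Fin 3 → ℂ) (A : Fin 3 → Matrix (Fin D) (Fin D) ℂ) (m : Fin 3) :
    mix (Matrix.diagonal d) A m = d m • A m := by
  simp [mix, Matrix.diagonal_apply]

lemma mix_gauge (P : Matrix (Fin 3) (Fin 3) ℂ) (A : Fin 3 → Matrix (Fin D) (Fin D) ℂ) (c : ℂ)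
    (U V : Matrix (Fin D) (Fin D) ℂ) :
    mix P (fun m => c • (U * A m * V)) = fun m => c • (U * mix P A m * V) := by
  funext m
  simp only [mix, Finset.mul_sum, Finset.sum_mul, Finset.smul_sum]
  refine Finset.sum_congr rfl fun n _ => ?_
  rw [smul_comm, Matrix.mul_smul, Matrix.smul_mul]

lemma mix_conjTranspose_mix_wireUnitary {A : Fin 3 → Matrix (Fin D) (Fin D) ℂ} :
    mix wireUnitaryᴴ (mix wireUnitary A) = A := by
  rw [mix_mix, wireUnitary_conjTranspose_mul, mix_one]

/-! ### Consequences of normality -/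

/-- The map `M ↦ c ^ L • (Vᴴ * M * V)` fixes all words of length `L`, which span the matrix algebra,
hence it is the identity. At `M = 1` this gives `c ^ L = 1`, so `V` is central. -/
lemma eq_smul_one_of_gauge {A : Fin 3 → Matrix (Fin D) (Fin D) ℂ} (hA : IsNormalTensor A)
    (hD : 0 < D) {c : ℂ} {V : Matrix (Fin D) (Fin D) ℂ} (hV : V ∈ Matrix.unitaryGroup (Fin D) ℂ)
    (h : ∀ m, A m = c • (Vᴴ * A m * V)) : ∃ μ : ℂ, ‖μ‖ = 1 ∧ V = μ • 1 := by
  have h1 : Vᴴ * V = 1 := Matrix.mem_unitaryGroup_iff'.mp hV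
  have h2 : V * Vᴴ = 1 := Matrix.mem_unitaryGroup_iff.mp hV
  obtain ⟨L, hL⟩ := hA
  let f : Matrix (Fin D) (Fin D) ℂ →ₗ[ℂ] Matrix (Fin D) (Fin D) ℂ :=
    c ^ L • (LinearMap.mulLeft ℂ Vᴴ ∘ₗ LinearMap.mulRight ℂ V)
  have hf : ∀ M, f M = c ^ L • (Vᴴ * M * V) := fun M => by
    simp [f, Matrix.mul_assoc]
  have hfid : f = LinearMap.id := by
    refine LinearMap.ext_on_range hL fun w => ?_
    rw [hf, ← wordProd_gauge A c hV, ← funext h, LinearMap.id_apply]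
  have hM : ∀ M, c ^ L • (Vᴴ * M * V) = M := fun M => by rw [← hf, hfid, LinearMap.id_apply]
  have : Nonempty (Fin D) := ⟨⟨0, hD⟩⟩
  have hc : c ^ L = 1 := by
    have := congrFun (congrFun (hM 1) ⟨0, hD⟩) ⟨0, hD⟩
    simpa [h1] using this
  have hcomm : ∀ M, M * V = V * M := fun M => by
    have := hM M
    rw [hc, one_smul] at this
    rw [← congrArg (V * ·) this]
    simp only [← Matrix.mul_assoc, h2, one_mul]
  obtain ⟨μ, hμ⟩ : V ∈ Set.range (Matrix.scalar (Fin D)) :=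
    Matrix.mem_range_scalar_iff_commute_single'.mpr fun i j => hcomm _
  have hμ' : V = μ • 1 := by rw [← hμ, Matrix.smul_one_eq_diagonal]; rfl
  refine ⟨μ, ?_, hμ'⟩
  rw [hμ'] at h1
  have := congrFun (congrFun h1 ⟨0, hD⟩) ⟨0, hD⟩
  simp only [Matrix.conjTranspose_smul, Matrix.conjTranspose_one, Matrix.smul_mul, one_mul,
    Matrix.smul_apply, Matrix.one_apply_eq, smul_eq_mul, mul_one] at this
  have h3 : (Complex.normSq μ : ℂ) = 1 := by rw [Complex.normSq_eq_conj_mul_self]; exact this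
  have h4 : Complex.normSq μ = 1 := by exact_mod_cast h3
  rw [Complex.normSq_eq_norm_sq] at h4
  nlinarith [norm_nonneg μ]

/-- Modulo the subgroup `{0, g₀}`, which acts by scalars, one generator `k` of order two remains. A
cyclic group has no non-trivial projective phase: rescaling `V k` to an involution gives a linear
representation. -/
lemma isLinearizable_of_scalar {V : G → Matrix (Fin D) (Fin D) ℂ}
    (hV : ∀ g, V g ∈ Matrix.unitaryGroup (Fin D) ℂ)
    (hproj : ∀ g h, ∃ c : ℂ, ‖c‖ = 1 ∧ V g * V h = c • V (g + h))
    {g₀ : G} (hg₀ : g₀ ≠ 0) (hs : ∃ μ : ℂ, ‖μ‖ = 1 ∧ V g₀ = μ • 1) : IsLinearizable V := by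
  have hne : ∀ {z : ℂ}, ‖z‖ = 1 → z ≠ 0 := fun {z} hz h0 => by simp [h0] at hz
  have hs0 : ∃ μ : ℂ, ‖μ‖ = 1 ∧ V 0 = μ • 1 := by
    obtain ⟨c, hc, h⟩ := hproj 0 0
    refine ⟨c, hc, ?_⟩
    have h1 : (V 0)ᴴ * V 0 = 1 := Matrix.mem_unitaryGroup_iff'.mp (hV 0)
    have := congrArg ((V 0)ᴴ * ·) h
    simpa [← Matrix.mul_assoc, h1] using this
  have hscal : ∀ g, g = 0 ∨ g = g₀ → ∃ μ : ℂ, ‖μ‖ = 1 ∧ V g = μ • 1 := by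
    rintro g (rfl | rfl)
    exacts [hs0, hs]
  obtain ⟨k, hk⟩ : ∃ k : G, ¬ (k = 0 ∨ k = g₀) := by
    clear hs hscal
    revert hg₀; revert g₀; decide
  have hcos : ∀ g : G, ¬ (g = 0 ∨ g = g₀) → (g + k = 0 ∨ g + k = g₀) := by
    clear hs hscal
    revert hk hg₀; revert g₀ k; decide
  have hhom : ∀ g h : G, (g + h = 0 ∨ g + h = g₀) ↔ ((g = 0 ∨ g = g₀) ↔ (h = 0 ∨ h = g₀)) := by
    clear hs hscal hcos hk
    revert hg₀; revert g₀; decide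
  have hsq : ∀ g : G, ¬ (g = 0 ∨ g = g₀) → ∃ μ : ℂ, ‖μ‖ = 1 ∧ V g * V k = μ • 1 := by
    intro g hg
    obtain ⟨c, hc, h⟩ := hproj g k
    obtain ⟨μ, hμ, h'⟩ := hscal _ (hcos g hg)
    exact ⟨c * μ, by simp [hc, hμ], by rw [h, h', smul_smul]⟩
  obtain ⟨d, hd, hVk⟩ := hsq k hk
  -- `V k` squares to `d`, so a square root of `d⁻¹` normalizes it to an involution.
  obtain ⟨e, he⟩ := IsAlgClosed.exists_pow_nat_eq d⁻¹ (n := 2) (by norm_num)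
  have he1 : ‖e‖ = 1 := by
    have := congrArg norm he
    rw [norm_pow, norm_inv, hd, inv_one] at this
    nlinarith [norm_nonneg e]
  have hT : (e • V k) * (e • V k) = 1 := by
    rw [Matrix.smul_mul, Matrix.mul_smul, hVk, smul_smul, smul_smul, ← pow_two, he,
      inv_mul_cancel₀ (hne hd), one_smul]
  have hβ : ∀ g, ∃ β : ℂ, ‖β‖ = 1 ∧ β • V g = if g = 0 ∨ g = g₀ then 1 else e • V k := by
    intro g
    split_ifs with hg
    · obtain ⟨μ, hμ, h⟩ := hscal g hg
      exact ⟨μ⁻¹, by simp [hμ], by rw [h, smul_smul, inv_mul_cancel₀ (hne hμ), one_smul]⟩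
    · obtain ⟨μ, hμ, h⟩ := hsq g hg
      have h1 : d • V g = μ • V k := by
        calc d • V g = V g * (V k * V k) := by rw [hVk, Matrix.mul_smul, mul_one]
          _ = μ • V k := by rw [← Matrix.mul_assoc, h, Matrix.smul_mul, one_mul]
      refine ⟨e * μ⁻¹ * d, by simp [he1, hμ, hd], ?_⟩
      rw [mul_smul, h1, smul_smul, mul_assoc, inv_mul_cancel₀ (hne hμ), mul_one]
  choose β hβ1 hβ2 using hβ
  refine ⟨β, hβ1, fun g h => ?_⟩
  rw [hβ2, hβ2, hβ2]
  have := hhom g h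
  by_cases hg : g = 0 ∨ g = g₀ <;> by_cases hh : h = 0 ∨ h = g₀ <;> simp [hg, hh, this, hT]

end words

/-! ### The wire components of a tensor with non-trivial fractionalization -/

section wire
variable {D : ℕ} {A : Fin 3 → Matrix (Fin D) (Fin D) ℂ}

lemma IsCanonical.pos (hA : IsCanonical A) : 0 < D := by
  obtain ⟨-, Λ, -, h, -⟩ := hA
  rcases Nat.eq_zero_or_pos D with rfl | h0
  · simp at h
  · exact h0

/-- Since `u` is a representation, `V g * V k` and `V (g + k)` implement the same on-site rotation.
Their quotient fixes `A` up to a phase and is scalar by normality. -/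
lemma projective_of_gauge (hA : IsNormalTensor A) (hD : 0 < D) {φ : G → ℝ}
    {V : G → Matrix (Fin D) (Fin D) ℂ} (hV : ∀ g, V g ∈ Matrix.unitaryGroup (Fin D) ℂ)
    (h : ∀ g, mix (u g) A = fun m => Complex.exp (φ g * Complex.I) • ((V g)ᴴ * A m * V g))
    (g k : G) : ∃ c : ℂ, ‖c‖ = 1 ∧ V g * V k = c • V (g + k) := by
  have h1 : ∀ g, (V g)ᴴ * V g = 1 := fun g => Matrix.mem_unitaryGroup_iff'.mp (hV g)
  have h2 : ∀ g, V g * (V g)ᴴ = 1 := fun g => Matrix.mem_unitaryGroup_iff.mp (hV g)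
  have h3 := h (g + k)
  rw [u_add, ← mix_mix, h k, mix_gauge, h g] at h3
  have hU : V g * V k * (V (g + k))ᴴ ∈ Matrix.unitaryGroup (Fin D) ℂ :=
    mul_mem (mul_mem (hV g) (hV k)) (Unitary.star_mem (hV _))
  obtain ⟨μ, hμ, hμ'⟩ := eq_smul_one_of_gauge hA hD (V := V g * V k * (V (g + k))ᴴ)
    (c := (Complex.exp (φ (g + k) * Complex.I))⁻¹ * (Complex.exp (φ k * Complex.I) *
      Complex.exp (φ g * Complex.I))) hU (fun m => by
    have h4 := congrArg (fun M => (Complex.exp (φ (g + k) * Complex.I))⁻¹ •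
      (V (g + k) * M * (V (g + k))ᴴ)) (congrFun h3 m)
    simp only [Matrix.mul_smul, Matrix.smul_mul] at h4
    rw [smul_smul _ (Complex.exp (φ (g + k) * Complex.I)), inv_mul_cancel₀ (Complex.exp_ne_zero _),
      one_smul] at h4
    simp only [Matrix.mul_assoc, h2, mul_one] at h4
    rw [← Matrix.mul_assoc (V (g + k)) (V (g + k))ᴴ, h2, one_mul] at h4
    refine h4.symm.trans ?_
    simp only [smul_smul, Matrix.conjTranspose_mul, Matrix.conjTranspose_conjTranspose,
      Matrix.mul_assoc]
    )
  refine ⟨μ, hμ, ?_⟩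
  have := congrArg (· * V (g + k)) hμ'
  simpa [Matrix.mul_assoc, h1] using this

lemma exists_flip (s : Fin 3) : ∃ g : G, g ≠ 0 ∧ ∀ t, t ≠ s → χ g t = -1 := by
  revert s; decide

/-- If one component vanished, the rotation about its axis would flip the sign of all the others,
hence of the whole tensor. Then `V g` would be scalar, contradicting non-trivial fractionalization.
-/
lemma mix_wireUnitary_ne_zero (hA : IsNormalTensor A) (hD : 0 < D) {φ : G → ℝ}
    {V : G → Matrix (Fin D) (Fin D) ℂ} (hV : ∀ g, V g ∈ Matrix.unitaryGroup (Fin D) ℂ)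
    (h : ∀ g, mix (u g) A = fun m => Complex.exp (φ g * Complex.I) • ((V g)ᴴ * A m * V g))
    (hlin : ¬ IsLinearizable V) (s : Fin 3) : mix wireUnitary A s ≠ 0 := by
  intro hs
  obtain ⟨g, hg, hχ⟩ := exists_flip s
  refine hlin (isLinearizable_of_scalar hV (projective_of_gauge hA hD hV h) hg ?_)
  refine eq_smul_one_of_gauge hA hD (c := -Complex.exp (φ g * Complex.I)) (hV g) fun m => ?_
  have h1 : mix (u g) A = mix wireUnitaryᴴ (mix (Matrix.diagonal fun s => (χ g s : ℂ))
      (mix wireUnitary A)) := by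
    rw [mix_mix, mix_mix, ← u_eq]
  have h2 : mix (Matrix.diagonal fun s => (χ g s : ℂ)) (mix wireUnitary A)
      = fun s => (-1 : ℂ) • (1 * mix wireUnitary A s * 1) := by
    funext t
    rw [mix_diagonal]
    by_cases hts : t = s
    · subst hts; simp [hs]
    · simp [hχ t hts]
  rw [h2, mix_gauge, mix_conjTranspose_mix_wireUnitary, h g] at h1
  have := congrFun h1 m
  simp only [one_mul, mul_one] at this
  rw [neg_smul, this]; simp

lemma sum_χ_mul_χ (s t : Fin 3) : ∑ g, χ g t * χ g s = if s = t then 4 else 0 := by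
  revert s t; decide

/-- Averaging the twisted conjugation over the group against `χ · t` projects onto component `t` by
orthogonality of characters. A non-zero entry of that component then serves as the functional; the
factor `4` is the group order. -/
lemma exists_dual (hcan : IsCanonical A) (hA : IsNormalTensor A)
    (hfrac : HasNontrivialFractionalization A) :
    ∃ l : Fin 3 → Matrix (Fin D) (Fin D) ℂ →ₗ[ℂ] ℂ,
      ∀ s t, l t (mix wireUnitary A s) = if s = t then 1 else 0 := by
  obtain ⟨φ, V, hV, h, hlin⟩ := hfrac
  replace h : ∀ g, mix (u g) A = fun m => Complex.exp (φ g * Complex.I) • ((V g)ᴴ * A m * V g) :=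
    fun g => funext fun m => h g m
  have hne := mix_wireUnitary_ne_zero hA hcan.pos hV h hlin
  have hex : ∀ t, ∃ i j, mix wireUnitary A t i j ≠ 0 := fun t => by
    by_contra! h0
    exact hne t (by ext i j; exact h0 i j)
  choose i j hij using hex
  have hχ : ∀ g s, Complex.exp (φ g * Complex.I) • ((V g)ᴴ * mix wireUnitary A s * V g)
      = (χ g s : ℂ) • mix wireUnitary A s := by
    intro g s
    rw [← mix_diagonal (fun s => (χ g s : ℂ)), mix_mix, ← wireUnitary_mul_u, ← mix_mix, h g,
      mix_gauge]
  refine ⟨fun t => (4 * mix wireUnitary A t (i t) (j t))⁻¹ • ∑ g, ((χ g t : ℂ) *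
    Complex.exp (φ g * Complex.I)) • (Matrix.entryLinearMap ℂ ℂ (i t) (j t) ∘ₗ
      LinearMap.mulLeft ℂ (V g)ᴴ ∘ₗ LinearMap.mulRight ℂ (V g)), fun s t => ?_⟩
  have h1 : ∀ g, (((χ g t : ℂ) * Complex.exp (φ g * Complex.I)) •
      (Matrix.entryLinearMap ℂ ℂ (i t) (j t) ∘ₗ LinearMap.mulLeft ℂ (V g)ᴴ ∘ₗ
        LinearMap.mulRight ℂ (V g))) (mix wireUnitary A s)
      = ((χ g t * χ g s : ℤ) : ℂ) * mix wireUnitary A s (i t) (j t) := fun g => by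
    have := congrFun (congrFun (hχ g s) (i t)) (j t)
    simp only [Matrix.smul_apply, smul_eq_mul, Matrix.mul_assoc] at this
    simp [mul_assoc, this]
  rw [LinearMap.smul_apply, LinearMap.sum_apply, Finset.sum_congr rfl fun g _ => h1 g,
    ← Finset.sum_mul, ← Int.cast_sum, sum_χ_mul_χ]
  split_ifs with hst
  · subst hst
    have := hij s
    simp only [smul_eq_mul]
    push_cast
    exact inv_mul_cancel₀ (mul_ne_zero (by norm_num) this)
  · simp

/-! ### Diagonal elements of the MPO tensors -/

lemma kronecker_star_sum {n : ℕ} (c : Fin n → ℂ) (B : Fin n → Matrix (Fin D) (Fin D) ℂ) :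
    (∑ m, c m • B m) ⊗ₖ (∑ m, c m • B m).map star
      = ∑ m, ∑ m', (c m * star (c m')) • (B m ⊗ₖ (B m').map star) := by
  ext ⟨a, a'⟩ ⟨b, b'⟩
  simp only [Matrix.kronecker_apply, Matrix.map_apply, Matrix.sum_apply, Matrix.smul_apply,
    smul_eq_mul, star_sum, star_mul', Finset.sum_mul_sum]
  refine Finset.sum_congr rfl fun m _ => Finset.sum_congr rfl fun m' _ => ?_
  ring

lemma inWireBasis_pureMPO (A : Fin 3 → Matrix (Fin D) (Fin D) ℂ) (s : Fin 3) :
    inWireBasis (pureMPO A) s s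
      = mix wireUnitary A s ⊗ₖ (mix wireUnitary A s).map star := by
  rw [mix, kronecker_star_sum]
  simp [inWireBasis, pureMPO, wireUnitary_apply]

lemma inWireBasis_onMPO (E : LocalChannel) (A : Fin 3 → Matrix (Fin D) (Fin D) ℂ) (s : Fin 3) :
    inWireBasis (E.onMPO (pureMPO A)) s s
      = ∑ p, mix (E.wireKraus p) (mix wireUnitary A) s ⊗ₖ
          (mix (E.wireKraus p) (mix wireUnitary A) s).map star := by
  have h : ∀ p, mix (E.wireKraus p) (mix wireUnitary A) s
      = ∑ n, (wireUnitary * E.K p) s n • A n := fun p => by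
    rw [mix_mix, LocalChannel.wireKraus_mul]; rfl
  simp only [h, kronecker_star_sum]
  simp only [inWireBasis, LocalChannel.onMPO, pureMPO, Finset.smul_sum, smul_smul]
  rw [Finset.sum_comm_cycle]
  refine Finset.sum_congr rfl fun p _ => ?_
  rw [Finset.sum_comm_cycle]
  refine Finset.sum_congr rfl fun n _ => ?_
  rw [Finset.sum_comm_cycle]
  refine Finset.sum_congr rfl fun n' _ => ?_
  simp only [Matrix.mul_apply, wireUnitary_apply, star_sum, Finset.sum_mul_sum, Finset.sum_smul]
  refine Finset.sum_congr rfl fun m _ => Finset.sum_congr rfl fun m' _ => ?_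
  congr 1
  simp only [Matrix.conjTranspose_apply, star_mul', star_star]
  ring

/-- The quantity `l M * star (l M)` depends linearly on `M ⊗ₖ M.map star`: it is the value of the
functional `l ⊗ l̄`. -/
lemma sum_mul_star_of_kronecker {κ : Type*} [Fintype κ] {Q : κ → Matrix (Fin D) (Fin D) ℂ}
    {B : Matrix (Fin D) (Fin D) ℂ}
    (h : ∑ p, Q p ⊗ₖ (Q p).map star = B ⊗ₖ B.map star) (l : Matrix (Fin D) (Fin D) ℂ →ₗ[ℂ] ℂ) :
    ∑ p, l (Q p) * star (l (Q p)) = l B * star (l B) := by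
  have hl : ∀ M, l M = ∑ i, ∑ j, M i j * l (Matrix.single i j 1) := fun M => by
    conv_lhs => rw [Matrix.matrix_eq_sum_single M]
    simp only [map_sum]
    refine Finset.sum_congr rfl fun i _ => Finset.sum_congr rfl fun j _ => ?_
    rw [← smul_eq_mul, ← map_smul, Matrix.smul_single, smul_eq_mul, mul_one]
  have hF : ∀ M : Matrix (Fin D) (Fin D) ℂ, l M * star (l M) = ∑ i, ∑ j, ∑ i', ∑ j',
      (M ⊗ₖ M.map star) (i, i') (j, j') *
        (l (Matrix.single i j 1) * star (l (Matrix.single i' j' 1))) := fun M => by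
    rw [hl M]
    simp only [Finset.sum_mul]
    simp only [star_sum, Finset.mul_sum, star_mul']
    refine Finset.sum_congr rfl fun i _ => Finset.sum_congr rfl fun j _ =>
      Finset.sum_congr rfl fun i' _ => Finset.sum_congr rfl fun j' _ => ?_
    simp only [Matrix.kronecker_apply, Matrix.map_apply]
    ring
  simp only [hF]
  rw [← h]
  simp only [Matrix.sum_apply, Finset.sum_mul]
  rw [Finset.sum_comm]
  refine Finset.sum_congr rfl fun i _ => ?_
  rw [Finset.sum_comm]
  refine Finset.sum_congr rfl fun j _ => ?_
  rw [Finset.sum_comm]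
  refine Finset.sum_congr rfl fun i' _ => ?_
  rw [Finset.sum_comm]

lemma isWireDiagonal_of_inWireBasis_eq {E : LocalChannel} (hcan : IsCanonical A)
    (hA : IsNormalTensor A) (hfrac : HasNontrivialFractionalization A)
    (h : ∀ s, inWireBasis (E.onMPO (pureMPO A)) s s = inWireBasis (pureMPO A) s s) :
    E.IsWireDiagonal := by
  obtain ⟨l, hl⟩ := exists_dual hcan hA hfrac
  intro p s t hst
  have h1 := h s
  rw [inWireBasis_onMPO, inWireBasis_pureMPO] at h1
  have h2 := sum_mul_star_of_kronecker h1 (l t)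
  have h3 : ∀ p, l t (mix (E.wireKraus p) (mix wireUnitary A) s) = E.wireKraus p s t := fun p => by
    rw [mix, map_sum]
    simp [hl]
  simp only [h3, hl, if_neg hst, zero_mul] at h2
  -- The functional annihilates the noiseless side because `s ≠ t`, leaving a vanishing sum of
  -- squared moduli.
  have h4 : ∑ p, Complex.normSq (E.wireKraus p s t) = 0 := by
    have : ∀ z : ℂ, z * star z = (Complex.normSq z : ℂ) := fun z => Complex.mul_conj z
    simp only [this] at h2
    exact_mod_cast h2
  rw [Finset.sum_eq_zero_iff_of_nonneg fun _ _ => Complex.normSq_nonneg _] at h4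
  exact Complex.normSq_eq_zero.mp (h4 p (Finset.mem_univ p))

lemma LocalChannel.IsWireDiagonal.sum_star_mul {E : LocalChannel} (hE : E.IsWireDiagonal)
    (s : Fin 3) : ∑ p, E.wireKraus p s s * star (E.wireKraus p s s) = 1 := by
  rw [← if_pos (c := s = s) rfl (t := (1 : ℂ)) (e := 0), ← E.sum_star_wireKraus s s]
  refine Finset.sum_congr rfl fun p _ => ?_
  rw [Finset.sum_eq_single s, mul_comm]
  · intro t _ hts; simp [hE p t s hts]
  · simp

lemma inWireBasis_eq_of_isWireDiagonal {E : LocalChannel} (hE : E.IsWireDiagonal)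
    (A : Fin 3 → Matrix (Fin D) (Fin D) ℂ) (s : Fin 3) :
    inWireBasis (E.onMPO (pureMPO A)) s s = inWireBasis (pureMPO A) s s := by
  rw [inWireBasis_onMPO, inWireBasis_pureMPO]
  have h : ∀ p, mix (E.wireKraus p) (mix wireUnitary A) s
      = E.wireKraus p s s • mix wireUnitary A s := fun p => by
    rw [mix, Finset.sum_eq_single s]
    · intro t _ hts; rw [hE p s t hts.symm, zero_smul]
    · simp
  simp only [h]
  ext ⟨a, a'⟩ ⟨b, b'⟩
  rw [Matrix.sum_apply, ← one_mul (Matrix.kroneckerMap _ _ _ _ _), ← hE.sum_star_mul s,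
    Finset.sum_mul]
  refine Finset.sum_congr rfl fun p _ => ?_
  simp only [Matrix.kronecker_apply, Matrix.map_apply, Matrix.smul_apply, smul_eq_mul, star_mul']
  ring

end wire

theorem inWireBasis_eq_iff {N : ℕ} (E : Fin N → LocalChannel) (ψ : HaldaneGroundState N) :
    (∀ (i : Fin N) (s : Fin 3), inWireBasis ((E i).onMPO (pureMPO ψ.A)) s s
      = inWireBasis (pureMPO ψ.A) s s) ↔ NoiseStronglySymmetric E := by
  rw [noiseStronglySymmetric_iff]
  exact forall_congr' fun i => ⟨isWireDiagonal_of_inWireBasis_eq ψ.canonical ψ.normal ψ.nontrivial,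
    fun h s => inWireBasis_eq_of_isWireDiagonal h ψ.A s⟩

/-! ### The identity-gate fidelity in terms of wire-basis amplitudes -/

section fidelity
variable {N : ℕ}

lemma onChain_mulVec (a b : Matrix (Fin 2) (Fin 2) ℂ)
    (M : Matrix (Fin N → Fin 3) (Fin N → Fin 3) ℂ) (φ : Chain N → ℂ) (σ τ : Fin 2)
    (m : Fin N → Fin 3) :
    (onChain a M b *ᵥ φ) (σ, m, τ)
      = ∑ σ', ∑ m', ∑ τ', a σ σ' * (M m m' * b τ τ') * φ (σ', m', τ') := by
  simp [Matrix.mulVec, dotProduct, onChain, Fintype.sum_prod_type]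

/-- The amplitudes of `φ` on the edge spins, for the outcome `s` of the measurement in the wire
basis. -/
def wireAmp (φ : Chain N → ℂ) (s : Fin N → Fin 3) : Matrix (Fin 2) (Fin 2) ℂ :=
  Matrix.of fun σ τ => (siteProd (fun _ => wireUnitary) *ᵥ fun m => φ (σ, m, τ)) s

/-- Here `M'` is `M` transported to the wire basis. The spin "out" labels the columns of the
amplitude matrix, hence the transpose of `b`. -/
lemma wireAmp_onChain (a b : Matrix (Fin 2) (Fin 2) ℂ) (M M' : Fin N → Matrix (Fin 3) (Fin 3) ℂ)
    (h : ∀ i, M' i * wireUnitary = wireUnitary * M i) (φ : Chain N → ℂ) (s : Fin N → Fin 3) :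
    wireAmp (onChain a (siteProd M) b *ᵥ φ) s = ∑ t, siteProd M' s t • (a * wireAmp φ t * bᵀ) := by
  ext σ τ
  have h1 : (fun m => (onChain a (siteProd M) b *ᵥ φ) (σ, m, τ))
      = siteProd M *ᵥ fun m => ∑ σ', ∑ τ', a σ σ' * b τ τ' * φ (σ', m, τ') := by
    funext m
    rw [onChain_mulVec]
    simp only [Matrix.mulVec, dotProduct, Finset.mul_sum]
    rw [Finset.sum_comm]
    refine Finset.sum_congr rfl fun _ _ => Finset.sum_congr rfl fun _ _ =>
      Finset.sum_congr rfl fun _ _ => ?_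
    ring
  have h2 : siteProd (fun _ => wireUnitary) * siteProd M
      = siteProd M' * siteProd (fun _ => wireUnitary) := by
    rw [siteProd_mul, siteProd_mul]; congr 1; funext i; rw [h]
  have h3 : (siteProd (fun _ => wireUnitary) *ᵥ
      fun m => ∑ σ', ∑ τ', a σ σ' * b τ τ' * φ (σ', m, τ'))
      = fun t => (a * wireAmp φ t * bᵀ) σ τ := by
    funext t
    simp only [Matrix.mul_apply, Fin.sum_univ_two, wireAmp, Matrix.of_apply, Matrix.mulVec,
      dotProduct, Matrix.transpose_apply, Finset.mul_sum, Finset.sum_mul,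
      ← Finset.sum_add_distrib]
    refine Finset.sum_congr rfl fun _ _ => ?_
    ring
  rw [wireAmp, Matrix.of_apply, h1, Matrix.mulVec_mulVec, h2, ← Matrix.mulVec_mulVec, h3,
    Matrix.sum_apply]
  simp [Matrix.mulVec, dotProduct]

lemma mul_vecMulVec_star_mul {n : Type*} [Fintype n] (O : Matrix n n ℂ) (φ : n → ℂ) :
    O * Matrix.vecMulVec φ (star φ) * Oᴴ = Matrix.vecMulVec (O *ᵥ φ) (star (O *ᵥ φ)) := by
  rw [Matrix.mul_vecMulVec, Matrix.vecMulVec_mul, Matrix.star_mulVec]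

lemma siteProd_wireProj (s m m' : Fin N → Fin 3) :
    siteProd (fun i => wireProj (s i)) m m' = star (siteProd (fun _ => wireUnitary) s m) *
      siteProd (fun _ => wireUnitary) s m' := by
  simp [siteProd, wireProj, Matrix.vecMulVec_apply, wireUnitary_apply, Finset.prod_mul_distrib]

lemma siteProd_wireUnitary_mul_conjTranspose :
    siteProd (fun _ : Fin N => wireUnitary) * (siteProd fun _ => wireUnitary)ᴴ = 1 := by
  rw [siteProd_conjTranspose, siteProd_mul, wireUnitary_mul_conjTranspose, siteProd_one]

lemma siteProd_wireUnitary_conjTranspose_mul :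
    (siteProd (fun _ : Fin N => wireUnitary))ᴴ * siteProd (fun _ => wireUnitary) = 1 :=
  mul_eq_one_comm.mp siteProd_wireUnitary_mul_conjTranspose

lemma onChain_wireProj_mulVec (B : Matrix (Fin 2) (Fin 2) ℂ) (s m : Fin N → Fin 3)
    (φ : Chain N → ℂ) (σ τ : Fin 2) :
    (onChain 1 (siteProd fun i => wireProj (s i)) B *ᵥ φ) (σ, m, τ)
      = star (siteProd (fun _ => wireUnitary) s m) * (wireAmp φ s * Bᵀ) σ τ := by
  rw [onChain_mulVec, Finset.sum_eq_single σ (fun σ' _ h => by simp [Matrix.one_apply_ne h.symm])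
    (by simp)]
  simp only [siteProd_wireProj, Matrix.mul_apply, Fin.sum_univ_two, wireAmp, Matrix.of_apply,
    Matrix.mulVec, dotProduct, Matrix.transpose_apply, Finset.mul_sum, Finset.sum_mul,
    ← Finset.sum_add_distrib, Matrix.one_apply_eq]
  refine Finset.sum_congr rfl fun _ _ => ?_
  ring

lemma trace_mul_bell (R : Matrix (Fin 2 × Fin 2) (Fin 2 × Fin 2) ℂ) :
    (R * Matrix.vecMulVec bell (star bell)).trace = 1 / 2 * ∑ i, ∑ j, R (i, i) (j, j) := by
  have h := inv_sqrt_two_mul_self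
  have h' := star_inv_sqrt_two
  have hb : ∀ p q, Matrix.vecMulVec bell (star bell) p q
      = if p.1 = p.2 ∧ q.1 = q.2 then 1 / 2 else 0 := by
    rintro ⟨p, p'⟩ ⟨q, q'⟩
    simp only [Matrix.vecMulVec_apply, bell, Pi.star_apply]
    split_ifs <;> simp_all
  simp only [Matrix.trace, Matrix.diag, Matrix.mul_apply, hb, Fintype.sum_prod_type,
    Fin.sum_univ_two]
  norm_num
  ring

lemma identityFidelity_eq (a b : Fin 2) (ρ : Matrix (Chain N) (Chain N) ℂ) :
    identityFidelity a b ρ = 1 / 2 * ∑ i, ∑ j, ∑ m, ∑ s : Fin N → Fin 3,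
      (onChain 1 (siteProd fun i => wireProj (s i)) (byproduct a b s) * ρ *
        (onChain 1 (siteProd fun i => wireProj (s i)) (byproduct a b s))ᴴ) (i, m, i) (j, m, j) := by
  simp only [identityFidelity, trace_mul_bell, outputState, traceBulk, Matrix.sum_apply]

lemma identityFidelity_sum {κ : Type*} [Fintype κ] (a b : Fin 2)
    (ρ : κ → Matrix (Chain N) (Chain N) ℂ) :
    identityFidelity a b (∑ α, ρ α) = ∑ α, identityFidelity a b (ρ α) := by
  let f : Matrix (Chain N) (Chain N) ℂ →+ ℂ := AddMonoidHom.mk' (identityFidelity a b)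
    fun ρ ρ' => by
      simp only [identityFidelity_eq, mul_add, add_mul, Matrix.add_apply, Finset.sum_add_distrib]
  exact map_sum f ρ Finset.univ

/-- The overlap of a two-qubit vector, written as a 2×2 matrix, with the Bell state is its trace
over `√2`. The bulk trace contributes one, because the wire states are normalized. -/
lemma identityFidelity_vecMulVec (a b : Fin 2) (φ : Chain N → ℂ) :
    identityFidelity a b (Matrix.vecMulVec φ (star φ))
      = ((∑ s, Complex.normSq (wireAmp φ s * (byproduct a b s)ᵀ).trace / 2 : ℝ) : ℂ) := by
  have hrow : ∀ s, ∑ m, star (siteProd (fun _ : Fin N => wireUnitary) s m) *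
      siteProd (fun _ => wireUnitary) s m = 1 := fun s => by
    have := congrFun (congrFun (siteProd_wireUnitary_mul_conjTranspose (N := N)) s) s
    rw [Matrix.mul_apply, Matrix.one_apply_eq] at this
    rw [← this]
    refine Finset.sum_congr rfl fun m _ => ?_
    rw [Matrix.conjTranspose_apply, mul_comm]
  have h : ∀ s i j m, (onChain 1 (siteProd fun i => wireProj (s i)) (byproduct a b s) *
        Matrix.vecMulVec φ (star φ) *
        (onChain 1 (siteProd fun i => wireProj (s i)) (byproduct a b s))ᴴ) (i, m, i) (j, m, j)
      = (star (siteProd (fun _ : Fin N => wireUnitary) s m) *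
      siteProd (fun _ => wireUnitary) s m) * ((wireAmp φ s * (byproduct a b s)ᵀ) i i *
        star ((wireAmp φ s * (byproduct a b s)ᵀ) j j)) := by
    intro s i j m
    rw [mul_vecMulVec_star_mul, Matrix.vecMulVec_apply, Pi.star_apply, onChain_wireProj_mulVec,
      onChain_wireProj_mulVec, star_mul', star_star]
    ring
  rw [identityFidelity_eq]
  simp only [h]
  have h2 : ∀ i j, (∑ m, ∑ s, (star (siteProd (fun _ : Fin N => wireUnitary) s m) *
      siteProd (fun _ => wireUnitary) s m) * ((wireAmp φ s * (byproduct a b s)ᵀ) i i *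
        star ((wireAmp φ s * (byproduct a b s)ᵀ) j j)))
      = ∑ s, (wireAmp φ s * (byproduct a b s)ᵀ) i i *
        star ((wireAmp φ s * (byproduct a b s)ᵀ) j j) := fun i j => by
    rw [Finset.sum_comm]
    refine Finset.sum_congr rfl fun s _ => ?_
    rw [← Finset.sum_mul, hrow, one_mul]
  simp only [h2]
  push_cast
  simp only [Complex.normSq_eq_conj_mul_self, Matrix.trace, Matrix.diag, Fin.sum_univ_two, map_add,
    ← Finset.sum_add_distrib, Finset.mul_sum]
  refine Finset.sum_congr rfl fun s _ => ?_
  simp only [← starRingEnd_apply]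
  ring

lemma identityFidelity_applyNoise (E : Fin N → LocalChannel) (a b : Fin 2) (φ : Chain N → ℂ) :
    identityFidelity a b (applyNoise E (Matrix.vecMulVec φ (star φ)))
      = ((∑ α, ∑ s, Complex.normSq (wireAmp (onChain 1 (noiseKraus E α) 1 *ᵥ φ) s *
          (byproduct a b s)ᵀ).trace / 2 : ℝ) : ℂ) := by
  rw [applyNoise, identityFidelity_sum]
  simp only [mul_vecMulVec_star_mul, identityFidelity_vecMulVec]
  push_cast
  rfl

lemma wireAmp_noiseKraus (E : Fin N → LocalChannel) (α : (i : Fin N) → Fin (E i).rank)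
    (φ : Chain N → ℂ) (s : Fin N → Fin 3) :
    wireAmp (onChain 1 (noiseKraus E α) 1 *ᵥ φ) s
      = ∑ t, siteProd (fun i => (E i).wireKraus (α i)) s t • wireAmp φ t := by
  rw [noiseKraus, wireAmp_onChain 1 1 _ _ (fun i => (E i).wireKraus_mul (α i))]
  simp

/-- Each Kraus branch multiplies the amplitude of outcome `s` by a scalar. By completeness, the
squared moduli of these scalars sum to one over the branches. -/
lemma identityFidelity_applyNoise_of_isWireDiagonal {E : Fin N → LocalChannel}
    (hE : ∀ i, (E i).IsWireDiagonal) (a b : Fin 2) (φ : Chain N → ℂ) :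
    identityFidelity a b (applyNoise E (Matrix.vecMulVec φ (star φ)))
      = identityFidelity a b (Matrix.vecMulVec φ (star φ)) := by
  rw [identityFidelity_applyNoise, identityFidelity_vecMulVec, Finset.sum_comm]
  congr 1
  refine Finset.sum_congr rfl fun s _ => ?_
  have h1 : ∀ α : (i : Fin N) → Fin (E i).rank, wireAmp (onChain 1 (noiseKraus E α) 1 *ᵥ φ) s
      = (∏ i, (E i).wireKraus (α i) (s i) (s i)) • wireAmp φ s := fun α => by
    rw [wireAmp_noiseKraus, Finset.sum_eq_single s]
    · rfl
    · intro t _ hts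
      obtain ⟨i, hi⟩ := Function.ne_iff.mp hts
      rw [siteProd, Finset.prod_eq_zero (Finset.mem_univ i) (hE i (α i) _ _ hi.symm), zero_smul]
    · simp
  have h2 : ∑ α : (i : Fin N) → Fin (E i).rank,
      ∏ i, Complex.normSq ((E i).wireKraus (α i) (s i) (s i)) = 1 := by
    have h3 : ∀ i, ∑ p, Complex.normSq ((E i).wireKraus p (s i) (s i)) = 1 := fun i => by
      have := (hE i).sum_star_mul (s i)
      have h4 : ∀ z : ℂ, z * star z = (Complex.normSq z : ℂ) := fun z => Complex.mul_conj z
      simp only [h4] at this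
      exact_mod_cast this
    have h5 := Finset.prod_univ_sum (fun i => (Finset.univ : Finset (Fin (E i).rank)))
      fun i p => Complex.normSq ((E i).wireKraus p (s i) (s i))
    rw [Fintype.piFinset_univ] at h5
    rw [← h5]
    exact Finset.prod_eq_one fun i _ => h3 i
  simp only [h1, Matrix.smul_mul, Matrix.trace_smul, smul_eq_mul, Complex.normSq_mul, map_prod,
    mul_div_assoc]
  rw [← Finset.sum_mul, h2, one_mul]

/-! ### Norms -/

lemma sum_normSq_mulVec {n κ : Type*} [Fintype n] [DecidableEq n] [Fintype κ]
    {M : κ → Matrix n n ℂ} (hM : ∑ α, (M α)ᴴ * M α = 1) (f : n → ℂ) :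
    ∑ α, ∑ s, Complex.normSq ((M α *ᵥ f) s) = ∑ m, Complex.normSq (f m) := by
  have hdot : ∀ v : n → ℂ, ((∑ s, Complex.normSq (v s) : ℝ) : ℂ) = star v ⬝ᵥ v := fun v => by
    push_cast
    simp only [Complex.normSq_eq_conj_mul_self, dotProduct]
    rfl
  apply Complex.ofReal_injective
  rw [hdot f, Complex.ofReal_sum]
  simp only [hdot]
  have h : ∀ α, star (M α *ᵥ f) ⬝ᵥ (M α *ᵥ f) = star f ⬝ᵥ (((M α)ᴴ * M α) *ᵥ f) := fun α => by
    rw [Matrix.star_mulVec, ← Matrix.dotProduct_mulVec, Matrix.mulVec_mulVec]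
  rw [Finset.sum_congr rfl fun α _ => h α, ← dotProduct_sum, ← Matrix.sum_mulVec, hM,
    Matrix.one_mulVec]

lemma sum_normSq_wireAmp (φ : Chain N → ℂ) :
    ∑ s, ∑ σ, ∑ τ, Complex.normSq (wireAmp φ s σ τ) = ∑ c, Complex.normSq (φ c) := by
  have h : ∀ σ τ, ∑ s, Complex.normSq (wireAmp φ s σ τ) = ∑ m, Complex.normSq (φ (σ, m, τ)) := by
    intro σ τ
    have := sum_normSq_mulVec (κ := Unit) (M := fun _ => siteProd fun _ : Fin N => wireUnitary)
      (by simpa using siteProd_wireUnitary_conjTranspose_mul) (fun m => φ (σ, m, τ))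
    simpa [wireAmp] using this
  rw [Finset.sum_comm]
  simp only [Fintype.sum_prod_type]
  refine Finset.sum_congr rfl fun σ _ => ?_
  rw [Finset.sum_comm, Finset.sum_congr rfl fun τ _ => h σ τ, Finset.sum_comm]

lemma sum_wireKraus_siteProd (E : Fin N → LocalChannel) :
    ∑ α : (i : Fin N) → Fin (E i).rank, (siteProd fun i => (E i).wireKraus (α i))ᴴ *
      siteProd (fun i => (E i).wireKraus (α i)) = 1 := by
  simp only [siteProd_conjTranspose, siteProd_mul]
  rw [sum_siteProd (fun i p => ((E i).wireKraus p)ᴴ * (E i).wireKraus p)]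
  simp only [LocalChannel.wireKraus_complete, siteProd_one]

lemma sum_normSq_wireAmp_noiseKraus (E : Fin N → LocalChannel) (φ : Chain N → ℂ) :
    ∑ α, ∑ s, ∑ σ, ∑ τ, Complex.normSq (wireAmp (onChain 1 (noiseKraus E α) 1 *ᵥ φ) s σ τ)
      = ∑ c, Complex.normSq (φ c) := by
  rw [← sum_normSq_wireAmp]
  have h : ∀ σ τ, ∑ α, ∑ s, Complex.normSq (wireAmp (onChain 1 (noiseKraus E α) 1 *ᵥ φ) s σ τ)
      = ∑ s, Complex.normSq (wireAmp φ s σ τ) := fun σ τ => by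
    rw [← sum_normSq_mulVec (sum_wireKraus_siteProd E) (fun s => wireAmp φ s σ τ)]
    refine Finset.sum_congr rfl fun α _ => Finset.sum_congr rfl fun s _ => ?_
    rw [wireAmp_noiseKraus, Matrix.sum_apply]
    rfl
  have hswap : ∀ F : (Fin N → Fin 3) → Fin 2 → Fin 2 → ℝ,
      ∑ s, ∑ σ, ∑ τ, F s σ τ = ∑ σ, ∑ τ, ∑ s, F s σ τ := fun F => by
    rw [Finset.sum_comm]
    exact Finset.sum_congr rfl fun σ _ => Finset.sum_comm
  simp only [hswap]
  rw [Finset.sum_comm]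
  refine Finset.sum_congr rfl fun σ _ => ?_
  rw [Finset.sum_comm]
  exact Finset.sum_congr rfl fun τ _ => h σ τ

/-! ### By-product operators -/

lemma X_mul_X : X * X = 1 := by
  ext i j; fin_cases i <;> fin_cases j <;> simp [X]

lemma Z_mul_Z : Z * Z = 1 := by
  ext i j; fin_cases i <;> fin_cases j <;> simp [Z]

lemma X_transpose : Xᵀ = X := by
  ext i j; fin_cases i <;> fin_cases j <;> simp [X]

lemma Z_transpose : Zᵀ = Z := by
  ext i j; fin_cases i <;> fin_cases j <;> simp [Z]

lemma pow_eq_one_or_self {M : Matrix (Fin 2) (Fin 2) ℂ} (h : M * M = 1) (n : ℕ) :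
    (M ^ n = 1 ∧ (-1 : ℂ) ^ n = 1) ∨ (M ^ n = M ∧ (-1 : ℂ) ^ n = -1) := by
  rcases Nat.even_or_odd' n with ⟨k, rfl | rfl⟩
  · left; simp [pow_mul, pow_two, h]
  · right; simp [pow_succ, pow_mul, h]

lemma sum_normSq_mul_byproduct (M : Matrix (Fin 2) (Fin 2) ℂ) (a b : Fin 2) (s : Fin N → Fin 3) :
    ∑ σ, ∑ τ, Complex.normSq ((M * (byproduct a b s)ᵀ) σ τ) = ∑ σ, ∑ τ, Complex.normSq (M σ τ) := by
  unfold byproduct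
  rcases pow_eq_one_or_self X_mul_X (countX s + a) with ⟨h, -⟩ | ⟨h, -⟩ <;>
  rcases pow_eq_one_or_self Z_mul_Z (countZ s + b) with ⟨h', -⟩ | ⟨h', -⟩ <;>
  rw [h, h', Matrix.eta_fin_two M, Matrix.transpose_mul] <;>
  simp only [X_transpose, Z_transpose, Matrix.transpose_one] <;>
  simp [X, Z, Fin.sum_univ_two] <;> ring

lemma isUnit_byproduct_transpose (a b : Fin 2) (s : Fin N → Fin 3) :
    IsUnit (byproduct a b s)ᵀ := by
  have hX : IsUnit X := IsUnit.of_mul_eq_one X X_mul_X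
  have hZ : IsUnit Z := IsUnit.of_mul_eq_one Z Z_mul_Z
  rw [Matrix.isUnit_transpose]
  exact (hX.pow _).mul (hZ.pow _)

/-- The bracket is the squared norm of the part orthogonal to the identity, so it measures the
distance from being scalar. -/
lemma normSq_trace_add_defect (M : Matrix (Fin 2) (Fin 2) ℂ) :
    ∑ σ, ∑ τ, Complex.normSq (M σ τ) = Complex.normSq M.trace / 2 + (Complex.normSq (M 0 1) +
      Complex.normSq (M 1 0) + Complex.normSq (M 0 0 - M 1 1) / 2) := by
  simp only [Fin.sum_univ_two, Matrix.trace, Matrix.diag, Complex.normSq_apply, Complex.add_re,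
    Complex.add_im, Complex.sub_re, Complex.sub_im]
  ring

lemma normSq_trace_of_scalar {M : Matrix (Fin 2) (Fin 2) ℂ} (h : ∃ c : ℂ, M = c • 1) :
    Complex.normSq M.trace / 2 = ∑ σ, ∑ τ, Complex.normSq (M σ τ) := by
  obtain ⟨c, rfl⟩ := h
  rw [normSq_trace_add_defect]
  simp

lemma scalar_of_sum_normSq_trace {κ : Type*} [Fintype κ] {M : κ → Matrix (Fin 2) (Fin 2) ℂ}
    (h : ∑ k, Complex.normSq (M k).trace / 2 = ∑ k, ∑ σ, ∑ τ, Complex.normSq (M k σ τ)) (k : κ) :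
    ∃ c : ℂ, M k = c • 1 := by
  rw [Finset.sum_congr rfl fun k _ => normSq_trace_add_defect (M k), Finset.sum_add_distrib] at h
  have h1 : ∑ k, (Complex.normSq (M k 0 1) + Complex.normSq (M k 1 0) +
      Complex.normSq (M k 0 0 - M k 1 1) / 2) = 0 := by linarith
  rw [Finset.sum_eq_zero_iff_of_nonneg fun k _ => by
    have := Complex.normSq_nonneg (M k 0 1)
    have := Complex.normSq_nonneg (M k 1 0)
    have := Complex.normSq_nonneg (M k 0 0 - M k 1 1)
    positivity] at h1
  have h2 := h1 k (Finset.mem_univ k)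
  have n1 := Complex.normSq_nonneg (M k 0 1)
  have n2 := Complex.normSq_nonneg (M k 1 0)
  have n3 := Complex.normSq_nonneg (M k 0 0 - M k 1 1)
  have e1 : M k 0 1 = 0 := Complex.normSq_eq_zero.mp (by linarith)
  have e2 : M k 1 0 = 0 := Complex.normSq_eq_zero.mp (by linarith)
  have e3 : M k 0 0 - M k 1 1 = 0 := Complex.normSq_eq_zero.mp (by linarith)
  refine ⟨M k 0 0, ?_⟩
  ext i j
  fin_cases i <;> fin_cases j <;> simp [e1, e2]
  linear_combination -e3

/-! ### Symmetric states implement the identity gate -/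

lemma prod_χ_x (s : Fin N → Fin 3) : ∏ i, (χ (1, 0) (s i) : ℂ) = (-1) ^ countZ s := by
  have h : ∀ t : Fin 3, (χ (1, 0) t : ℂ) = if t = 1 ∨ t = 2 then -1 else 1 := by
    intro t; fin_cases t <;> simp [χ]
  simp [h, Finset.prod_ite, countZ]

lemma prod_χ_z (s : Fin N → Fin 3) : ∏ i, (χ (0, 1) (s i) : ℂ) = (-1) ^ countX s := by
  have h : ∀ t : Fin 3, (χ (0, 1) t : ℂ) = if t = 0 ∨ t = 1 then -1 else 1 := by
    intro t; fin_cases t <;> simp [χ]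
  simp [h, Finset.prod_ite, countX]

lemma wireAmp_symmetry (φ : Chain N → ℂ) (g : G) (s : Fin N → Fin 3) :
    wireAmp (onChain (pauli g) (siteProd fun _ => u g) (pauli g) *ᵥ φ) s
      = (∏ i, (χ g (s i) : ℂ)) • (pauli g * wireAmp φ s * (pauli g)ᵀ) := by
  rw [wireAmp_onChain _ _ _ _ (fun _ => (wireUnitary_mul_u g).symm), siteProd_diagonal,
    Finset.sum_eq_single s]
  · simp
  · intro t _ hts; simp [Matrix.diagonal_apply_ne _ hts.symm]
  · simp

lemma wireAmp_smul (c : ℂ) (φ : Chain N → ℂ) (s : Fin N → Fin 3) :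
    wireAmp (c • φ) s = c • wireAmp φ s := by
  ext σ τ
  simp only [wireAmp, Matrix.of_apply, Matrix.smul_apply]
  rw [← Pi.smul_apply, ← Matrix.mulVec_smul]
  rfl

/-- The charge of a state under a symmetry that acts by an involution `P` on the edge spins. -/
lemma exists_charge {P : Matrix (Fin 2) (Fin 2) ℂ} (hP : P * P = 1) {ι : Type*} {c : ℂ}
    {k : ι → ℕ} {M : ι → Matrix (Fin 2) (Fin 2) ℂ}
    (h : ∀ s, (-1 : ℂ) ^ k s • (P * M s * P) = c • M s) :
    ∃ a : Fin 2, ∀ s, P * M s * P = (-1 : ℂ) ^ (k s + (a : ℕ)) • M s := by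
  have h1 : ∀ s, P * M s * P = ((-1 : ℂ) ^ k s * c) • M s := fun s => by
    rw [mul_smul, ← h s, smul_smul, ← mul_pow]; simp
  by_cases h0 : ∃ s, M s ≠ 0
  · obtain ⟨s, hs⟩ := h0
    have h2 : M s = (c * c) • M s := by
      calc M s = (P * P) * M s * (P * P) := by rw [hP, one_mul, mul_one]
        _ = P * (P * M s * P) * P := by simp only [Matrix.mul_assoc]
        _ = (((-1 : ℂ) ^ k s * c) * ((-1 : ℂ) ^ k s * c)) • M s := by
          rw [h1 s, Matrix.mul_smul, Matrix.smul_mul, h1 s, smul_smul]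
        _ = (c * c) • M s := by
          congr 1
          have : (-1 : ℂ) ^ k s * (-1 : ℂ) ^ k s = 1 := by rw [← mul_pow]; simp
          linear_combination c * c * this
    have h3 : (c * c - 1) • M s = 0 := by rw [sub_smul, one_smul, ← h2, sub_self]
    rcases smul_eq_zero.mp h3 with h4 | h4
    · have : c = 1 ∨ c = -1 := by
        have : (c - 1) * (c + 1) = 0 := by linear_combination h4
        rcases mul_eq_zero.mp this with h5 | h5
        · left; linear_combination h5
        · right; linear_combination h5
      rcases this with rfl | rfl
      · exact ⟨0, fun s => by rw [h1 s]; simp⟩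
      · exact ⟨1, fun s => by rw [h1 s, pow_add]; simp⟩
    · exact absurd h4 hs
  · push Not at h0
    exact ⟨0, fun s => by simp [h0 s]⟩

/-- The signs under conjugation by `X` and `Z` determine `M` up to a factor as a Pauli product. The
exponents cross over because conjugation by `X` detects powers of `Z`, and conversely. -/
lemma scalar_of_charges {M : Matrix (Fin 2) (Fin 2) ℂ} {p q : ℕ}
    (hX : X * M * X = (-1 : ℂ) ^ q • M) (hZ : Z * M * Z = (-1 : ℂ) ^ p • M) :
    ∃ c : ℂ, M * (X ^ p * Z ^ q)ᵀ = c • 1 := by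
  rw [Matrix.eta_fin_two M] at *
  generalize M 0 0 = m₀₀ at *
  generalize M 0 1 = m₀₁ at *
  generalize M 1 0 = m₁₀ at *
  generalize M 1 1 = m₁₁ at *
  refine ⟨(!![m₀₀, m₀₁; m₁₀, m₁₁] * (X ^ p * Z ^ q)ᵀ) 0 0, ?_⟩
  rcases pow_eq_one_or_self X_mul_X p with ⟨h, e⟩ | ⟨h, e⟩ <;>
  rcases pow_eq_one_or_self Z_mul_Z q with ⟨h', e'⟩ | ⟨h', e'⟩ <;>
  rw [h, h', Matrix.transpose_mul] <;>
  simp only [X_transpose, Z_transpose, Matrix.transpose_one] <;> rw [e'] at hX <;> rw [e] at hZ <;> clear h h' e e' <;>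
  simp [X, Z, ← Matrix.ext_iff, Fin.forall_fin_two] at hX hZ ⊢ <;> grind

lemma exists_identityFidelity_eq_one {φ : Chain N → ℂ} (hnorm : ∑ c, ‖φ c‖ ^ 2 = 1)
    (hsym : ∀ g : G, ∃ θ : ℝ, onChain (pauli g) (siteProd fun _ => u g) (pauli g) *ᵥ φ
      = Complex.exp ((θ : ℂ) * Complex.I) • φ) :
    ∃ a b : Fin 2, identityFidelity a b (Matrix.vecMulVec φ (star φ)) = 1 := by
  have hpx : pauli (1, 0) = X := by simp [pauli]
  have hpz : pauli (0, 1) = Z := by simp [pauli]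
  obtain ⟨θx, hθx⟩ := hsym (1, 0)
  obtain ⟨θz, hθz⟩ := hsym (0, 1)
  -- The charge of the x-rotation fixes the exponent `b` of `Z`, and that of the z-rotation the
  -- exponent `a` of `X`.
  obtain ⟨b, hb⟩ := exists_charge X_mul_X (k := countZ) (M := wireAmp φ)
    (c := Complex.exp (θx * Complex.I)) fun s => by
      rw [← wireAmp_smul, ← hθx, wireAmp_symmetry, prod_χ_x, hpx, X_transpose]
  obtain ⟨a, ha⟩ := exists_charge Z_mul_Z (k := countX) (M := wireAmp φ)
    (c := Complex.exp (θz * Complex.I)) fun s => by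
      rw [← wireAmp_smul, ← hθz, wireAmp_symmetry, prod_χ_z, hpz, Z_transpose]
  refine ⟨a, b, ?_⟩
  rw [identityFidelity_vecMulVec]
  have h : ∀ s, Complex.normSq (wireAmp φ s * (byproduct a b s)ᵀ).trace / 2
      = ∑ σ, ∑ τ, Complex.normSq (wireAmp φ s σ τ) := fun s => by
    rw [normSq_trace_of_scalar (M := wireAmp φ s * (byproduct a b s)ᵀ)
      (scalar_of_charges (hb s) (ha s)), sum_normSq_mul_byproduct]
  rw [Finset.sum_congr rfl fun s _ => h s, sum_normSq_wireAmp]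
  simp only [Complex.normSq_eq_norm_sq, hnorm, Complex.ofReal_one]

end fidelity

/-! ### Products of site-dependent tensors -/

section products
variable {N D : ℕ}

lemma sum_siteProd_smul_wordProd (P : Fin N → Matrix (Fin 3) (Fin 3) ℂ)
    (A : Fin 3 → Matrix (Fin D) (Fin D) ℂ) (s : Fin N → Fin 3) :
    ∑ t, siteProd P s t • wordProd A t = (List.ofFn fun i => mix (P i) A (s i)).prod := by
  induction N with
  | zero => simp [siteProd, wordProd_zero]
  | succ N ih =>
    rw [List.ofFn_succ, List.prod_cons, ← ih (fun i => P i.succ) (fun i => s i.succ),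
      ← (Fin.consEquiv fun _ => Fin 3).sum_comp, Fintype.sum_prod_type, mix, Finset.sum_mul_sum]
    refine Finset.sum_congr rfl fun t _ => Finset.sum_congr rfl fun t' _ => ?_
    rw [wordProd_succ, Matrix.smul_mul, Matrix.mul_smul, smul_smul]
    simp [siteProd, Fin.prod_univ_succ, Fin.consEquiv]

/-- Completeness of the Kraus operators inverts the noise: noiseless words are combinations of noisy
ones, so the noisy ones cannot all vanish when some noiseless word is non-zero. -/
lemma wordProd_eq_sum_wireKraus (E : Fin N → LocalChannel) (A : Fin 3 → Matrix (Fin D) (Fin D) ℂ)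
    (t : Fin N → Fin 3) :
    wordProd A t = ∑ α : (i : Fin N) → Fin (E i).rank, ∑ s,
      star (siteProd (fun i => (E i).wireKraus (α i)) s t) •
        (List.ofFn fun i => mix ((E i).wireKraus (α i)) A (s i)).prod := by
  simp only [← sum_siteProd_smul_wordProd, Finset.smul_sum, smul_smul]
  have h : ∀ t', ∑ α : (i : Fin N) → Fin (E i).rank, ∑ s,
      star (siteProd (fun i => (E i).wireKraus (α i)) s t) *
        siteProd (fun i => (E i).wireKraus (α i)) s t' = if t = t' then 1 else 0 := fun t' => by
    have := congrFun (congrFun (sum_wireKraus_siteProd E) t) t'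
    simpa only [Matrix.sum_apply, Matrix.mul_apply, Matrix.conjTranspose_apply,
      Matrix.one_apply] using this
  have h2 : ∀ α : (i : Fin N) → Fin (E i).rank, ∑ s, ∑ t',
      (star (siteProd (fun i => (E i).wireKraus (α i)) s t) *
        siteProd (fun i => (E i).wireKraus (α i)) s t') • wordProd A t'
      = ∑ t', (∑ s, star (siteProd (fun i => (E i).wireKraus (α i)) s t) *
        siteProd (fun i => (E i).wireKraus (α i)) s t') • wordProd A t' := fun α => by
    rw [Finset.sum_comm]
    simp only [Finset.sum_smul]
  rw [Finset.sum_congr rfl fun α _ => h2 α, Finset.sum_comm]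
  simp only [← Finset.sum_smul, h]
  simp

lemma LocalChannel.eq_sum_wireKraus (E : LocalChannel) (A : Fin 3 → Matrix (Fin D) (Fin D) ℂ)
    (t : Fin 3) :
    A t = ∑ p, ∑ s, star (E.wireKraus p s t) • mix (E.wireKraus p) A s := by
  simp only [mix, Finset.smul_sum, smul_smul]
  have h2 : ∀ p, ∑ s, ∑ t', (star (E.wireKraus p s t) * E.wireKraus p s t') • A t'
      = ∑ t', (∑ s, star (E.wireKraus p s t) * E.wireKraus p s t') • A t' := fun p => by
    rw [Finset.sum_comm]
    simp only [Finset.sum_smul]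
  rw [Finset.sum_congr rfl fun p _ => h2 p, Finset.sum_comm]
  simp only [← Finset.sum_smul, E.sum_star_wireKraus]
  simp

end products

/-! ### The AKLT state -/

lemma inv_sqrt_three_mul_self : ((Real.sqrt 3 : ℂ))⁻¹ * ((Real.sqrt 3 : ℂ))⁻¹ = 1 / 3 := by
  rw [← mul_inv, ← Complex.ofReal_mul, Real.mul_self_sqrt (by norm_num)]; norm_num

lemma inv_sqrt_three_ne_zero : ((Real.sqrt 3 : ℂ))⁻¹ ≠ 0 := fun h => by
  have := inv_sqrt_three_mul_self
  rw [h] at this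
  norm_num at this

lemma inv_sqrt_two_ne_zero : ((Real.sqrt 2 : ℂ))⁻¹ ≠ 0 := fun h => by
  have := inv_sqrt_two_mul_self
  rw [h] at this
  norm_num at this

lemma star_inv_sqrt_three : star ((Real.sqrt 3 : ℂ))⁻¹ = ((Real.sqrt 3 : ℂ))⁻¹ := by
  simp [Complex.conj_ofReal]

/-- The wire components `σˢ/√3` of the AKLT tensor. -/
def akltWire (s : Fin 3) : Matrix (Fin 2) (Fin 2) ℂ := ((Real.sqrt 3 : ℂ))⁻¹ • ![X, Y, Z] s

/-- The AKLT tensor, in the `Sᶻ`-basis. -/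
def akltTensor : Fin 3 → Matrix (Fin 2) (Fin 2) ℂ := mix wireUnitaryᴴ akltWire

lemma mix_wireUnitary_akltTensor : mix wireUnitary akltTensor = akltWire := by
  rw [akltTensor, mix_mix, wireUnitary_mul_conjTranspose, mix_one]

lemma akltTensor_eq (m : Fin 3) : akltTensor m = ![
    (((Real.sqrt 3 : ℂ))⁻¹ * ((Real.sqrt 2 : ℂ))⁻¹) • !![0, 0; -2, 0],
    ((Real.sqrt 3 : ℂ))⁻¹ • !![1, 0; 0, -1],
    (((Real.sqrt 3 : ℂ))⁻¹ * ((Real.sqrt 2 : ℂ))⁻¹) • !![0, 2; 0, 0]] m := by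
  have hI := Complex.I_mul_I
  rw [akltTensor, mix, wireUnitary_conjTranspose]
  unfold akltWire X Y Z
  generalize ((Real.sqrt 2 : ℂ))⁻¹ = r
  generalize ((Real.sqrt 3 : ℂ))⁻¹ = c
  fin_cases m <;> ext i j <;> fin_cases i <;> fin_cases j <;>
    simp [Fin.sum_univ_three] <;> grind

lemma conjTranspose_fin_two (a b c d : ℂ) :
    !![a, b; c, d]ᴴ = !![star a, star c; star b, star d] := by
  ext i j
  fin_cases i <;> fin_cases j <;> rfl

lemma isCanonical_akltTensor : IsCanonical akltTensor := by
  have h2 := inv_sqrt_two_mul_self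
  have h3 := inv_sqrt_three_mul_self
  have s2 := star_inv_sqrt_two
  have s3 := star_inv_sqrt_three
  -- The AKLT Schmidt spectrum is flat, so `Λ² = 1/2`.
  refine ⟨?_, fun _ => Real.sqrt (1 / 2), fun _ => by positivity, ?_, ?_⟩
  · simp only [akltTensor_eq]
    generalize ((Real.sqrt 2 : ℂ))⁻¹ = r at *
    generalize ((Real.sqrt 3 : ℂ))⁻¹ = c at *
    rw [Complex.star_def] at s2 s3
    ext i j
    fin_cases i <;> fin_cases j <;>
      simp [Fin.sum_univ_three, conjTranspose_fin_two, s2, s3] <;> grind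
  · simp
  · simp only [akltTensor_eq]
    have hΛ : (((Real.sqrt (1 / 2)) ^ 2 : ℝ) : ℂ) = 1 / 2 := by
      rw [Real.sq_sqrt (by norm_num)]; norm_num
    have hd : Matrix.diagonal (fun _ : Fin 2 => (((Real.sqrt (1 / 2)) ^ 2 : ℝ) : ℂ))
        = !![1 / 2, 0; 0, 1 / 2] := by
      simp only [hΛ]
      ext i j
      fin_cases i <;> fin_cases j <;> simp
    rw [hd]
    clear hΛ hd
    generalize ((Real.sqrt 2 : ℂ))⁻¹ = r at *
    generalize ((Real.sqrt 3 : ℂ))⁻¹ = c at *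
    rw [Complex.star_def] at s2 s3
    ext i j
    fin_cases i <;> fin_cases j <;>
      simp [Fin.sum_univ_three, conjTranspose_fin_two, s2, s3] <;> grind

lemma isNormalTensor_akltTensor : IsNormalTensor akltTensor := by
  have n2 := inv_sqrt_two_ne_zero
  have n3 := inv_sqrt_three_ne_zero
  -- One site spans only the traceless matrices; the four chosen products of two sites are non-zero
  -- multiples of the matrix units.
  refine ⟨2, eq_top_iff.mpr fun M _ => ?_⟩
  have hmem : ∀ w : Fin 2 → Fin 3, akltTensor (w 0) * akltTensor (w 1) ∈ Submodule.span ℂ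
      (Set.range fun m : Fin 2 → Fin 3 => wordProd akltTensor m) := fun w =>
    Submodule.subset_span ⟨w, by simp [wordProd, List.ofFn_succ]⟩
  have hsum : ∀ c : Fin 4 → ℂ, c 0 • (akltTensor 2 * akltTensor 0) +
      c 1 • (akltTensor 1 * akltTensor 2) + c 2 • (akltTensor 1 * akltTensor 0) +
      c 3 • (akltTensor 0 * akltTensor 2) ∈ Submodule.span ℂ
      (Set.range fun m : Fin 2 → Fin 3 => wordProd akltTensor m) := fun c =>
    add_mem (add_mem (add_mem (Submodule.smul_mem _ _ (hmem ![2, 0]))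
      (Submodule.smul_mem _ _ (hmem ![1, 2]))) (Submodule.smul_mem _ _ (hmem ![1, 0])))
      (Submodule.smul_mem _ _ (hmem ![0, 2]))
  simp only [akltTensor_eq] at hsum
  generalize ((Real.sqrt 2 : ℂ))⁻¹ = r at *
  generalize ((Real.sqrt 3 : ℂ))⁻¹ = c at *
  convert hsum ![-(M 0 0 / (4 * c ^ 2 * r ^ 2)), M 0 1 / (2 * c ^ 2 * r),
    M 1 0 / (2 * c ^ 2 * r), -(M 1 1 / (4 * c ^ 2 * r ^ 2))] using 1
  ext i j
  fin_cases i <;> fin_cases j <;> simp <;> field_simp <;> ring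

lemma pauli_mem_unitaryGroup (g : G) : pauli g ∈ Matrix.unitaryGroup (Fin 2) ℂ := by
  rw [Matrix.mem_unitaryGroup_iff]
  unfold pauli
  split_ifs <;> ext i j <;> fin_cases i <;> fin_cases j <;>
    simp [X, Y, Z, Matrix.star_eq_conjTranspose, Matrix.mul_apply, Fin.sum_univ_two]

lemma pauli_conj_akltWire (g : G) (s : Fin 3) :
    (pauli g)ᴴ * akltWire s * pauli g = (χ g s : ℂ) • akltWire s := by
  have hI := Complex.I_mul_I
  unfold pauli χ akltWire
  generalize ((Real.sqrt 3 : ℂ))⁻¹ = c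
  split_ifs <;> fin_cases s <;> ext i j <;> fin_cases i <;> fin_cases j <;>
    simp [X, Y, Z, Matrix.mul_apply, Fin.sum_univ_two] <;> grind

lemma mix_u_akltTensor (g : G) :
    mix (u g) akltTensor = fun m => (1 : ℂ) • ((pauli g)ᴴ * akltTensor m * pauli g) := by
  have h : mix (Matrix.diagonal fun s => (χ g s : ℂ)) akltWire
      = fun s => (1 : ℂ) • ((pauli g)ᴴ * akltWire s * pauli g) := by
    funext s
    rw [mix_diagonal, pauli_conj_akltWire, one_smul]
  rw [u_eq, ← mix_mix, mix_wireUnitary_akltTensor, ← mix_mix, h, mix_gauge]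
  rfl

/-- Rescaled `X` and `Z` would have to commute, but they anticommute. -/
lemma not_isLinearizable_pauli : ¬ IsLinearizable pauli := by
  rintro ⟨β, hβ, h⟩
  have h1 := h (1, 0) (0, 1)
  have h2 := h (0, 1) (1, 0)
  rw [add_comm, h1] at h2
  have hne : ∀ g, β g ≠ 0 := fun g h0 => by simpa [h0] using hβ g
  have h3 := congrFun (congrFun h2 0) 1
  have n1 := hne (1, 0)
  have n2 := hne (0, 1)
  simp [pauli, X, Z] at h3
  have h4 : β (1, 0) * β (0, 1) = 0 := by grind
  exact mul_ne_zero n1 n2 h4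

lemma hasNontrivialFractionalization_akltTensor :
    HasNontrivialFractionalization akltTensor := by
  refine ⟨fun _ => 0, pauli, pauli_mem_unitaryGroup, fun g m => ?_, not_isLinearizable_pauli⟩
  simpa [mix] using congrFun (mix_u_akltTensor g) m

lemma pauli_mul_transpose (g : G) :
    ∃ θ : ℝ, pauli g * (pauli g)ᵀ = Complex.exp (θ * Complex.I) • 1 := by
  unfold pauli
  split_ifs
  · exact ⟨0, by rw [X_transpose, X_mul_X]; simp⟩
  · refine ⟨Real.pi, ?_⟩
    rw [Complex.exp_pi_mul_I]
    ext i j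
    fin_cases i <;> fin_cases j <;> simp [Y, Matrix.mul_apply, Fin.sum_univ_two]
  · exact ⟨0, by rw [Z_transpose, Z_mul_Z]; simp⟩
  · exact ⟨0, by simp⟩

/-- Left end of the AKLT state. -/
def akltLeft (σ : Fin 2) : Fin 2 → ℂ := Pi.single σ 1

/-- Right end of the AKLT state. -/
def akltRight (σ : Fin 2) : Fin 2 → ℂ := Pi.single σ ((Real.sqrt 2 : ℂ))⁻¹

section aklt
variable {N : ℕ}

lemma mpsState_aklt (σ τ : Fin 2) (m : Fin N → Fin 3) :
    mpsState akltTensor akltLeft akltRight (σ, m, τ)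
      = wordProd akltTensor m σ τ * ((Real.sqrt 2 : ℂ))⁻¹ := by
  simp [mpsState, akltLeft, akltRight]

lemma wireAmp_mpsState_aklt (s : Fin N → Fin 3) :
    wireAmp (mpsState akltTensor akltLeft akltRight) s
      = ((Real.sqrt 2 : ℂ))⁻¹ • wordProd akltWire s := by
  have h := sum_siteProd_smul_wordProd (fun _ : Fin N => wireUnitary) akltTensor s
  rw [mix_wireUnitary_akltTensor] at h
  rw [wordProd, ← h]
  ext σ τ
  simp only [wireAmp, Matrix.of_apply, Matrix.mulVec, dotProduct, mpsState_aklt,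
    Matrix.smul_apply, Matrix.sum_apply, smul_eq_mul, Finset.mul_sum]
  refine Finset.sum_congr rfl fun m _ => ?_
  ring

lemma akltWire_mul_self (s : Fin 3) : akltWire s * akltWire s = (1 / 3 : ℂ) • 1 := by
  have h3 := inv_sqrt_three_mul_self
  have hI := Complex.I_mul_I
  unfold akltWire
  generalize ((Real.sqrt 3 : ℂ))⁻¹ = c at *
  fin_cases s <;> ext i j <;> fin_cases i <;> fin_cases j <;>
    simp [X, Y, Z, Matrix.mul_apply, Fin.sum_univ_two] <;> grind

lemma akltWire_conjTranspose (s : Fin 3) : (akltWire s)ᴴ = akltWire s := by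
  have s3 := star_inv_sqrt_three
  unfold akltWire
  generalize ((Real.sqrt 3 : ℂ))⁻¹ = c at *
  rw [Complex.star_def] at s3
  fin_cases s <;> ext i j <;> fin_cases i <;> fin_cases j <;> simp [X, Y, Z, s3]

lemma wordProd_akltWire_mul_conjTranspose (s : Fin N → Fin 3) :
    wordProd akltWire s * (wordProd akltWire s)ᴴ = ((1 / 3 : ℂ) ^ N) • 1 := by
  induction N with
  | zero => simp [wordProd_zero]
  | succ N ih =>
    rw [wordProd_succ, Matrix.conjTranspose_mul, Matrix.mul_assoc, ← Matrix.mul_assoc (wordProd _ _),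
      ih, Matrix.smul_mul, one_mul, Matrix.mul_smul, akltWire_conjTranspose, akltWire_mul_self,
      smul_smul, pow_succ]

lemma sum_normSq_eq_trace (M : Matrix (Fin 2) (Fin 2) ℂ) :
    ((∑ σ, ∑ τ, Complex.normSq (M σ τ) : ℝ) : ℂ) = (M * Mᴴ).trace := by
  push_cast
  simp only [Matrix.trace, Matrix.diag, Matrix.mul_apply, Matrix.conjTranspose_apply,
    ← Complex.mul_conj, ← starRingEnd_apply]

lemma norm_mpsState_aklt :
    ∑ c : Chain N, ‖mpsState akltTensor akltLeft akltRight c‖ ^ 2 = 1 := by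
  simp only [← Complex.normSq_eq_norm_sq]
  rw [← sum_normSq_wireAmp]
  apply Complex.ofReal_injective
  rw [Complex.ofReal_sum]
  simp only [sum_normSq_eq_trace, wireAmp_mpsState_aklt, Matrix.conjTranspose_smul,
    Matrix.smul_mul, Matrix.mul_smul, smul_smul, wordProd_akltWire_mul_conjTranspose,
    star_inv_sqrt_two]
  have h2 := inv_sqrt_two_mul_self
  have h3 : (3 : ℂ) ^ N * (3 ^ N)⁻¹ = 1 := mul_inv_cancel₀ (pow_ne_zero _ three_ne_zero)
  simp
  linear_combination 2 * (3 : ℂ) ^ N * (3 ^ N)⁻¹ * h2 + h3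

/-- The bulk rotation conjugates the virtual word by `pauli g`. The rotation of "in" cancels the
left factor, and that of "out" leaves `pauli g * (pauli g)ᵀ`, a sign. -/
lemma symmetric_mpsState_aklt (g : G) : ∃ θ : ℝ,
    onChain (pauli g) (siteProd fun _ => u g) (pauli g) *ᵥ
        (mpsState akltTensor akltLeft akltRight : Chain N → ℂ)
      = Complex.exp ((θ : ℂ) * Complex.I) •
        (mpsState akltTensor akltLeft akltRight : Chain N → ℂ) := by
  obtain ⟨θ, hθ⟩ := pauli_mul_transpose g
  refine ⟨θ, ?_⟩
  funext ⟨σ, m, τ⟩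
  have h1 : ∑ n, siteProd (fun _ => u g) m n • wordProd akltTensor n
      = (pauli g)ᴴ * wordProd akltTensor m * pauli g := by
    rw [sum_siteProd_smul_wordProd, mix_u_akltTensor]
    have := wordProd_gauge akltTensor 1 (pauli_mem_unitaryGroup g) m
    rw [one_pow, one_smul] at this
    exact this
  have hP : pauli g * (pauli g)ᴴ = 1 := Matrix.mem_unitaryGroup_iff.mp (pauli_mem_unitaryGroup g)
  have h2 : pauli g * (∑ n, siteProd (fun _ => u g) m n • wordProd akltTensor n) * (pauli g)ᵀ
      = Complex.exp (θ * Complex.I) • wordProd akltTensor m := by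
    rw [h1]
    simp only [← Matrix.mul_assoc]
    rw [hP, one_mul, Matrix.mul_assoc, hθ, Matrix.mul_smul, mul_one]
  rw [onChain_mulVec, Pi.smul_apply, mpsState_aklt, smul_eq_mul, ← mul_assoc,
    ← smul_eq_mul (a := Complex.exp _), ← Matrix.smul_apply, ← h2]
  simp only [mpsState_aklt, Matrix.mul_apply, Matrix.sum_apply, Matrix.smul_apply, smul_eq_mul,
    Fin.sum_univ_two, Matrix.transpose_apply, Finset.sum_mul, Finset.mul_sum,
    ← Finset.sum_add_distrib]
  refine Finset.sum_congr rfl fun n _ => ?_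
  ring

/-- The AKLT state on `N` sites. -/
def aklt (N : ℕ) : HaldaneGroundState N where
  D := 2
  A := akltTensor
  l := akltLeft
  r := akltRight
  normal := isNormalTensor_akltTensor
  canonical := isCanonical_akltTensor
  nontrivial := hasNontrivialFractionalization_akltTensor
  norm_one := norm_mpsState_aklt
  symmetric := symmetric_mpsState_aklt

/-! ### Noise that keeps the identity gate on the AKLT state -/

lemma akltWire_trace (s : Fin 3) : (akltWire s).trace = 0 := by
  unfold akltWire
  fin_cases s <;> simp [X, Y, Z, Matrix.trace, Fin.sum_univ_two]

lemma akltWire_mul_trace {s t : Fin 3} (h : s ≠ t) : (akltWire s * akltWire t).trace = 0 := by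
  unfold akltWire
  fin_cases s <;> fin_cases t <;> simp [X, Y, Z, Matrix.trace, Fin.sum_univ_two] at h ⊢

lemma akltWire_ne_zero (s : Fin 3) : akltWire s ≠ 0 := fun h => by
  have := akltWire_mul_self s
  rw [h, mul_zero] at this
  simpa using congrFun (congrFun this 0) 0

lemma wordProd_akltWire_ne_zero (s : Fin N → Fin 3) : wordProd akltWire s ≠ 0 := fun h => by
  have := wordProd_akltWire_mul_conjTranspose s
  rw [h, zero_mul] at this
  have h0 := congrFun (congrFun this 0) 0
  simp only [Matrix.zero_apply, Matrix.smul_apply, Matrix.one_apply_eq, smul_eq_mul, mul_one] at h0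
  exact pow_ne_zero N (by norm_num) h0.symm

lemma akltWire_mul_left_cancel {s : Fin 3} {M M' : Matrix (Fin 2) (Fin 2) ℂ}
    (h : akltWire s * M = akltWire s * M') : M = M' := by
  have := congrArg ((3 : ℂ) • akltWire s * ·) h
  simpa [← Matrix.mul_assoc, akltWire_mul_self] using this

/-- The Pauli matrices and the identity form a trace-orthogonal basis. -/
lemma scalar_of_trace_akltWire_mul {S : Matrix (Fin 2) (Fin 2) ℂ}
    (h : ∀ t, (akltWire t * S).trace = 0) : ∃ μ : ℂ, S = μ • 1 := by
  have n3 := inv_sqrt_three_ne_zero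
  have hI := Complex.I_mul_I
  have hI0 := Complex.I_ne_zero
  have hX := h 0
  have hY := h 1
  have hZ := h 2
  refine ⟨S 0 0, ?_⟩
  rw [Matrix.eta_fin_two S] at *
  simp [akltWire, X, Y, Z, Matrix.trace, Fin.sum_univ_two] at hX hY hZ
  ext i j
  fin_cases i <;> fin_cases j <;> simp <;> grind

/-- A product of factors may be proportional to the right word without each factor being so, since
invertible matrices could hide between sites. Completeness and tracelessness of the Pauli matrices
show that such a matrix to the right of the first site is scalar; that site then splits off, and
induction handles the rest. -/
lemma exists_mix_wireKraus_eq_smul {E : Fin N → LocalChannel}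
    (h : ∀ (α : (i : Fin N) → Fin (E i).rank) (s : Fin N → Fin 3), ∃ c : ℂ,
      (List.ofFn fun i => mix ((E i).wireKraus (α i)) akltWire (s i)).prod
        = c • wordProd akltWire s) (i : Fin N) (p : Fin (E i).rank) (s : Fin 3) :
    ∃ c : ℂ, mix ((E i).wireKraus p) akltWire s = c • akltWire s := by
  induction N with
  | zero => exact i.elim0
  | succ N ih =>
    have hcons : ∀ (p : Fin (E 0).rank) (s : Fin 3)
        (α : (i : Fin N) → Fin (E i.succ).rank) (t : Fin N → Fin 3), ∃ c : ℂ,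
        mix ((E 0).wireKraus p) akltWire s *
          (List.ofFn fun i => mix ((E i.succ).wireKraus (α i)) akltWire (t i)).prod
        = c • (akltWire s * wordProd akltWire t) := by
      intro p s α t
      obtain ⟨c, hc⟩ := h (Fin.cons p α) (Fin.cons s t)
      refine ⟨c, ?_⟩
      rw [wordProd_succ, List.ofFn_succ, List.prod_cons] at hc
      simpa using hc
    have hfirst : ∀ (p : Fin (E 0).rank) (s : Fin 3), ∃ c : ℂ,
        mix ((E 0).wireKraus p) akltWire s = c • akltWire s := by
      obtain ⟨α, t, hR⟩ : ∃ (α : (i : Fin N) → Fin (E i.succ).rank) (t : Fin N → Fin 3),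
          (List.ofFn fun i => mix ((E i.succ).wireKraus (α i)) akltWire (t i)).prod ≠ 0 := by
        by_contra! h0
        have := wordProd_eq_sum_wireKraus (fun i : Fin N => E i.succ) akltWire (fun _ => 0)
        simp only [h0, smul_zero, Finset.sum_const_zero] at this
        exact wordProd_akltWire_ne_zero _ this
      set R := (List.ofFn fun i => mix ((E i.succ).wireKraus (α i)) akltWire (t i)).prod
      have hS : ∀ p s, ∃ c : ℂ, mix ((E 0).wireKraus p) akltWire s *
          (R * (wordProd akltWire t)ᴴ) = c • akltWire s := fun p s => by
        obtain ⟨c, hc⟩ := hcons p s α t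
        refine ⟨c * (1 / 3) ^ N, ?_⟩
        rw [← Matrix.mul_assoc, hc, Matrix.smul_mul, Matrix.mul_assoc,
          wordProd_akltWire_mul_conjTranspose, Matrix.mul_smul, mul_one, smul_smul]
      -- Expanding `akltWire t'` in noisy components, each of which becomes a multiple of a
      -- traceless Pauli matrix when multiplied by `R * (wordProd akltWire t)ᴴ`, shows that this
      -- matrix has no Pauli part.
      obtain ⟨μ, hμ⟩ := scalar_of_trace_akltWire_mul (S := R * (wordProd akltWire t)ᴴ) fun t' => by
        rw [(E 0).eq_sum_wireKraus akltWire t', Finset.sum_mul, Matrix.trace_sum]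
        refine Finset.sum_eq_zero fun p _ => ?_
        rw [Finset.sum_mul, Matrix.trace_sum]
        refine Finset.sum_eq_zero fun s _ => ?_
        obtain ⟨c, hc⟩ := hS p s
        rw [Matrix.smul_mul, hc, Matrix.trace_smul, Matrix.trace_smul, akltWire_trace, smul_zero,
          smul_zero]
      have hμ0 : μ ≠ 0 := by
        rintro rfl
        have h1 := congrArg (· * wordProd akltWire t) hμ
        have h2 := mul_eq_one_comm.mp (show ((3 : ℂ) ^ N • wordProd akltWire t) *
          (wordProd akltWire t)ᴴ = 1 by
            rw [Matrix.smul_mul, wordProd_akltWire_mul_conjTranspose, smul_smul, ← mul_pow]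
            norm_num)
        rw [Matrix.mul_smul] at h2
        have h3 : R = (3 : ℂ) ^ N • (R * (wordProd akltWire t)ᴴ * wordProd akltWire t) := by
          rw [Matrix.mul_assoc, ← Matrix.mul_smul, h2, mul_one]
        rw [hμ] at h3
        exact hR (by simpa using h3)
      intro p s
      obtain ⟨c, hc⟩ := hS p s
      refine ⟨μ⁻¹ * c, ?_⟩
      rw [mul_smul, ← hc, hμ, Matrix.mul_smul, mul_one, smul_smul, inv_mul_cancel₀ hμ0, one_smul]
    refine Fin.cases (motive := fun i => ∀ p, ∃ c : ℂ,
      mix ((E i).wireKraus p) akltWire s = c • akltWire s) (fun p => hfirst p s) (fun i p => ?_) i p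
    refine ih (E := fun i => E i.succ) (fun α t => ?_) i p
    -- A non-vanishing branch on the first site can be cancelled, which passes the hypothesis to the
    -- remaining sites.
    obtain ⟨q, s', hq⟩ : ∃ q s', mix ((E 0).wireKraus q) akltWire s' ≠ 0 := by
      by_contra! h0
      have := (E 0).eq_sum_wireKraus akltWire 0
      simp only [h0, smul_zero, Finset.sum_const_zero] at this
      exact akltWire_ne_zero _ this
    obtain ⟨d, hd⟩ := hfirst q s'
    obtain ⟨c, hc⟩ := hcons q s' α t
    have hd0 : d ≠ 0 := by rintro rfl; exact hq (by rw [hd, zero_smul])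
    refine ⟨d⁻¹ * c, akltWire_mul_left_cancel (s := s') ?_⟩
    rw [Matrix.mul_smul, mul_smul, ← hc, hd, Matrix.smul_mul, smul_smul, inv_mul_cancel₀ hd0,
      one_smul]

lemma isWireDiagonal_of_mix_eq_smul {E : LocalChannel}
    (h : ∀ p s, ∃ c : ℂ, mix (E.wireKraus p) akltWire s = c • akltWire s) : E.IsWireDiagonal := by
  intro p s t hst
  obtain ⟨c, hc⟩ := h p s
  have h1 := congrArg (fun M => (akltWire t * M).trace) hc
  simp only [mix, Finset.mul_sum, Matrix.trace_sum, Matrix.mul_smul, Matrix.trace_smul,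
    akltWire_mul_trace hst.symm, smul_zero] at h1
  rw [Finset.sum_eq_single t (fun t' _ h' => by rw [akltWire_mul_trace h'.symm, smul_zero])
    (by simp), akltWire_mul_self] at h1
  simpa using h1

/-- Both fidelities saturate the norm, so noisy and noiseless amplitudes become scalar under the
same invertible by-product. The noiseless one is non-zero, hence the noisy one is a multiple of it.
-/
lemma isWireDiagonal_of_identityFidelity_aklt {E : Fin N → LocalChannel} {a b : Fin 2}
    (h1 : identityFidelity a b (aklt N).density = 1)
    (h2 : identityFidelity a b (applyNoise E (aklt N).density) = 1) (i : Fin N) :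
    (E i).IsWireDiagonal := by
  have n2 := inv_sqrt_two_ne_zero
  refine isWireDiagonal_of_mix_eq_smul fun p s =>
    exists_mix_wireKraus_eq_smul (fun α s => ?_) i p s
  clear p
  let ψ : Chain N → ℂ := mpsState akltTensor akltLeft akltRight
  have hnorm : ∑ c, Complex.normSq (ψ c) = 1 := by
    simp only [Complex.normSq_eq_norm_sq]
    exact norm_mpsState_aklt
  change identityFidelity a b (Matrix.vecMulVec ψ (star ψ)) = 1 at h1
  change identityFidelity a b (applyNoise E (Matrix.vecMulVec ψ (star ψ))) = 1 at h2
  rw [identityFidelity_vecMulVec, Complex.ofReal_eq_one, ← hnorm, ← sum_normSq_wireAmp] at h1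
  rw [identityFidelity_applyNoise, Complex.ofReal_eq_one, ← hnorm,
    ← sum_normSq_wireAmp_noiseKraus E] at h2
  obtain ⟨c, hc⟩ := scalar_of_sum_normSq_trace
    (M := fun s => wireAmp ψ s * (byproduct a b s)ᵀ) (by
      rw [h1]; simp only [sum_normSq_mul_byproduct]) s
  obtain ⟨d, hd⟩ := scalar_of_sum_normSq_trace
    (M := fun k : ((i : Fin N) → Fin (E i).rank) × (Fin N → Fin 3) =>
      wireAmp (onChain 1 (noiseKraus E k.1) 1 *ᵥ ψ) k.2 * (byproduct a b k.2)ᵀ) (by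
      rw [Fintype.sum_prod_type, Fintype.sum_prod_type, h2]
      simp only [sum_normSq_mul_byproduct]) (α, s)
  have hψ : ∀ s, wireAmp ψ s = ((Real.sqrt 2 : ℂ))⁻¹ • wordProd akltWire s := wireAmp_mpsState_aklt
  have hB := isUnit_byproduct_transpose a b s
  have hnoise : wireAmp (onChain 1 (noiseKraus E α) 1 *ᵥ ψ) s = ((Real.sqrt 2 : ℂ))⁻¹ •
      (List.ofFn fun i => mix ((E i).wireKraus (α i)) akltWire (s i)).prod := by
    rw [wireAmp_noiseKraus, ← sum_siteProd_smul_wordProd, Finset.smul_sum]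
    refine Finset.sum_congr rfl fun t _ => ?_
    rw [hψ, smul_comm]
  simp only at hc hd
  have hc0 : c ≠ 0 := by
    rintro rfl
    rw [zero_smul, hB.mul_left_eq_zero, hψ] at hc
    exact wordProd_akltWire_ne_zero s ((smul_eq_zero_iff_right n2).mp hc)
  have hprop : wireAmp (onChain 1 (noiseKraus E α) 1 *ᵥ ψ) s = (d * c⁻¹) • wireAmp ψ s := by
    apply hB.mul_right_cancel
    rw [hd, Matrix.smul_mul, hc, smul_smul, mul_assoc, inv_mul_cancel₀ hc0, mul_one]
  refine ⟨d * c⁻¹, ?_⟩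
  rw [hnoise, hψ, smul_comm] at hprop
  exact smul_right_injective _ n2 hprop

end aklt

theorem identityFidelity_eq_one_iff {N : ℕ} (E : Fin N → LocalChannel) :
    (∀ ψ : HaldaneGroundState N, ∃ a b : Fin 2, identityFidelity a b ψ.density = 1 ∧
      identityFidelity a b (applyNoise E ψ.density) = 1) ↔ NoiseStronglySymmetric E := by
  rw [noiseStronglySymmetric_iff]
  constructor
  · intro h
    obtain ⟨a, b, h1, h2⟩ := h (aklt N)
    exact isWireDiagonal_of_identityFidelity_aklt h1 h2
  · intro hE ψ
    obtain ⟨a, b, h⟩ := exists_identityFidelity_eq_one ψ.norm_one ψ.symmetric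
    refine ⟨a, b, h, ?_⟩
    rw [HaldaneGroundState.density, identityFidelity_applyNoise_of_isWireDiagonal hE]
    exact h

end HaldaneMPO

end

theorem proposition4 (N : ℕ) (E : Fin N → HaldaneMPO.LocalChannel) :
    (∀ ψ : HaldaneMPO.HaldaneGroundState N,
      (∀ (i : Fin N) (s : Fin 3),
        HaldaneMPO.inWireBasis ((E i).onMPO (HaldaneMPO.pureMPO ψ.A)) s s
          = HaldaneMPO.inWireBasis (HaldaneMPO.pureMPO ψ.A) s s)
        ↔ HaldaneMPO.NoiseStronglySymmetric E) ∧
    ((∀ ψ : HaldaneMPO.HaldaneGroundState N, ∃ a b : Fin 2,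
        HaldaneMPO.identityFidelity a b ψ.density = 1 ∧
        HaldaneMPO.identityFidelity a b (HaldaneMPO.applyNoise E ψ.density) = 1)
      ↔ HaldaneMPO.NoiseStronglySymmetric E) :=
  ⟨HaldaneMPO.inWireBasis_eq_iff E, HaldaneMPO.identityFidelity_eq_one_iff E⟩
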